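/- Let $n\ge 2$ and let $E\subset\mathbb R^n$ be any set (not necessarily closed or measurable) with $\mathscr H^{n-1}(E)=0$, where $\mathscr H^{n-1}$ is the $(n-1)$-dimensional Hausdorff measure. Then $E$ is negligible for extremal distances ($E\in \mathit{NED}$); that is, for every pair of non-empty, disjoint continua (compact connected sets) $F_1,F_2\subset\mathbb R^n$ we have $$\operatorname{mod}_n \Gamma(F_1,F_2;\mathbb R^n)=\operatorname{mod}_n\bigl(\Gamma(F_1,F_2;\mathbb R^n)\cap\mathcal F_0(E)\bigr).$$ Here a path is a continuous map $\gamma:[a,b]\to\mathbb R^n$ on a compact interval; $\Gamma(F_1,F_2;\mathbb R^n)$ is the family of paths $\gamma:[a,b]\to\mathbb R^n$ with $\gamma(a)\in F_1$ and $\gamma(b)\in F_2$; $\mathcal F_0(E)$ is the family of paths $\gamma:[a,b]\to\mathbb R^n$ such that $\gamma([a,b])\setminus\{\gamma(a),\gamma(b)\}$ does not intersect $E$; and for a path family $\Gamma$, $$\operatorname{mod}_n\Gamma=\inf_\rho\int_{\mathbb R^n}\rho(x)^n\,dx\in[0,\infty],$$ where the infimum (equal to $\infty$ if there is no such $\rho$)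 is over all Borel functions $\rho:\mathbb R^n\to[0,\infty]$ with $\int_\gamma\rho\,ds\ge1$ for every rectifiable path $\gamma\in\Gamma$, the line integral being taken with respect to arclength. -/

import Mathlib

open MeasureTheory Set
open scoped ENNReal

namespace QCNed

/-- A path (curve) in `ℝⁿ`: a continuous map on a compact interval `[a, b]`.
Only the values of `toFun` on `[a, b]` are ever used. -/
structure Curve (n : ℕ) where
  a : ℝ
  b : ℝ
  le : a ≤ b
  toFun : ℝ → EuclideanSpace ℝ (Fin n)
  cont : ContinuousOn toFun (Icc a b)

namespace Curve

variable {n : ℕ}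

/-- The trace `|γ| = γ([a, b])`. -/
def trace (γ : Curve n) : Set (EuclideanSpace ℝ (Fin n)) :=
  γ.toFun '' Icc γ.a γ.b

/-- The endpoints `∂γ = {γ(a), γ(b)}`. -/
def endpoints (γ : Curve n) : Set (EuclideanSpace ℝ (Fin n)) :=
  {γ.toFun γ.a, γ.toFun γ.b}

/-- The length `ℓ(γ)`: the total variation of `γ` on `[a, b]`. -/
noncomputable def length (γ : Curve n) : ℝ≥0∞ :=
  eVariationOn γ.toFun (Icc γ.a γ.b)

/-- A path is rectifiable if it has finite length. -/
def Rectifiable (γ : Curve n) : Prop :=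
  γ.length ≠ ∞

/-- The arclength parametrization of a rectifiable path, to be considered on `[0, ℓ(γ)]`:
it sends `t` to `γ(u)` for any `u ∈ [a, b]` such that `γ` has length `t` on `[a, u]`. -/
noncomputable def arclengthParam (γ : Curve n) : ℝ → EuclideanSpace ℝ (Fin n) :=
  naturalParameterization γ.toFun (Icc γ.a γ.b) γ.a

/-- The line integral `∫_γ ρ ds = ∫_0^{ℓ(γ)} ρ(γ̃(t)) dt`, where `γ̃` is the arclength
parametrization of the rectifiable path `γ`. -/
noncomputable def lineIntegral (γ : Curve n) (ρ : EuclideanSpace ℝ (Fin n) → ℝ≥0∞) : ℝ≥0∞ :=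
  ∫⁻ t in Icc (0 : ℝ) γ.length.toReal, ρ (γ.arclengthParam t)

end Curve

/-- A Borel function `ρ : ℝⁿ → [0, ∞]` is admissible for the path family `Γ` if
`∫_γ ρ ds ≥ 1` for every rectifiable path `γ ∈ Γ`. -/
structure Admissible {n : ℕ} (Γ : Set (Curve n)) (ρ : EuclideanSpace ℝ (Fin n) → ℝ≥0∞) :
    Prop where
  measurable : Measurable ρ
  one_le_lineIntegral : ∀ γ ∈ Γ, γ.Rectifiable → 1 ≤ γ.lineIntegral ρ

/-- The `p`-modulus `inf_ρ ∫ ρ^p` over all admissible `ρ`; it is `∞` if there are none. -/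
noncomputable def modulus {n : ℕ} (p : ℝ) (Γ : Set (Curve n)) : ℝ≥0∞ :=
  ⨅ (ρ : EuclideanSpace ℝ (Fin n) → ℝ≥0∞) (_ : Admissible Γ ρ), ∫⁻ x, ρ x ^ p

/-- `Γ(F₁, F₂; U)`: the paths `γ : [a, b] → closure U` with `γ(a) ∈ F₁`, `γ(b) ∈ F₂` and
`γ((a, b)) ⊆ U`. -/
def joiningFamily {n : ℕ} (F₁ F₂ U : Set (EuclideanSpace ℝ (Fin n))) : Set (Curve n) :=
  {γ | γ.trace ⊆ closure U ∧ γ.toFun γ.a ∈ F₁ ∧ γ.toFun γ.b ∈ F₂ ∧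
    γ.toFun '' Ioo γ.a γ.b ⊆ U}

/-- `𝓕₀(E)`: the paths that do not meet `E`, except possibly at their endpoints. -/
def avoidingFamily {n : ℕ} (E : Set (EuclideanSpace ℝ (Fin n))) : Set (Curve n) :=
  {γ | Disjoint (γ.trace \ γ.endpoints) E}

/-- A non-empty continuum: a non-empty compact connected set. -/
def IsContinuum {n : ℕ} (F : Set (EuclideanSpace ℝ (Fin n))) : Prop :=
  IsCompact F ∧ IsConnected F

/-- `E ⊆ ℝⁿ` (not necessarily closed or measurable) is negligible for extremal distances:
`mod_n Γ(F₁, F₂; ℝⁿ) = mod_n (Γ(F₁, F₂; ℝⁿ) ∩ 𝓕₀(E))` for all non-empty, disjoint continua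
`F₁, F₂ ⊆ ℝⁿ`. -/
def IsNED {n : ℕ} (E : Set (EuclideanSpace ℝ (Fin n))) : Prop :=
  ∀ F₁ F₂ : Set (EuclideanSpace ℝ (Fin n)),
    IsContinuum F₁ → IsContinuum F₂ → Disjoint F₁ F₂ →
      modulus (n : ℝ) (joiningFamily F₁ F₂ univ) =
        modulus (n : ℝ) (joiningFamily F₁ F₂ univ ∩ avoidingFamily E)

end QCNed

/-! Only "≤" needs proof: the family avoiding `E` is smaller. Let `ρ` be admissible for it with
finite energy, and replace `ρ` by its mean over balls of radius `R`. By Jensen and translation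
invariance the energy does not grow (`lintegral_ballMean_rpow_le`), and the line integral of the
mean along an arc `γ` is the average of the line integrals of `ρ` along the translates `γ + x`, `|x|
≤ R`.

Almost every translate misses `E`: the exceptional `x` lie in the set of differences `e - γ(t)`,
which is null because an arc adds only one dimension to `E` (`volume_image2_eq_zero`). A translate
no longer ends on `F₁` and `F₂`, so short connecting arcs are attached. They exist between good
points, where the energy in small balls decays linearly: two segments through a generic intermediate
point miss `E` and are cheap (`joinedBy_of_isGoodPoint`). A Vitali covering shows that most
translated endpoints are good, and that a continuum contains good points near each of its points
(`exists_isGoodPoint_of_isPreconnected`).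

Hence translates cost at least `1 - δ` with probability at least `1 - δ`, so the mean divided by `(1
- δ)²` is admissible for all joining paths; let `δ → 0`. If some `Fᵢ` is a single point, both moduli
vanish (`modulus_eq_zero_of_endpoint`). -/

namespace QCNed

open Filter Topology

/-! ### Unit speed maps and continuity of the variation function. -/

section UnitSpeed

variable {X : Type*} [PseudoMetricSpace X]

/-- Continuity lets the variation function attain every value between 0 and the length, so that the
arclength parametrization is controlled on the whole interval. -/
theorem continuousOn_variationOnFromTo {f : ℝ → X} {s : Set ℝ} {a : ℝ}
    (hf : LocallyBoundedVariationOn f s) (ha : a ∈ s) (hc : ContinuousOn f s) :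
    ContinuousOn (variationOnFromTo f s a) s := by
  intro x hx
  have hs : s = (s ∩ Iio x) ∪ ({x} ∪ (s ∩ Ioi x)) := by
    ext y
    simp only [mem_union, mem_inter_iff, mem_Iio, mem_singleton_iff, mem_Ioi]
    constructor
    · intro hy
      rcases lt_trichotomy y x with h | h | h
      · exact Or.inl ⟨hy, h⟩
      · exact Or.inr (Or.inl h)
      · exact Or.inr (Or.inr ⟨hy, h⟩)
    · rintro (h | h | h)
      · exact h.1
      · exact h ▸ hx
      · exact h.1
  have h1 : ContinuousWithinAt (variationOnFromTo f s a) (s ∩ Iio x) x := by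
    have := variationOnFromTo.tendsto_left ha hx hf
      ((hc x hx).mono (inter_subset_left (t := Iio x))).tendsto
    simpa [ContinuousWithinAt] using this
  have h2 : ContinuousWithinAt (variationOnFromTo f s a) (s ∩ Ioi x) x := by
    have := variationOnFromTo.tendsto_right ha hx hf
      ((hc x hx).mono (inter_subset_left (t := Ioi x))).tendsto
    simpa [ContinuousWithinAt] using this
  have h3 := h1.union (continuousWithinAt_singleton.union h2)
  rwa [← hs] at h3

theorem _root_.HasUnitSpeedOn.lipschitzOnWith {f : ℝ → X} {s : Set ℝ} (hf : HasUnitSpeedOn f s) :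
    LipschitzOnWith 1 f s := by
  have key : ∀ x ∈ s, ∀ y ∈ s, x ≤ y → edist (f x) (f y) ≤ edist x y := by
    intro x hx y hy hxy
    have := hf hx hy
    rw [NNReal.coe_one, one_mul] at this
    rw [edist_comm x, edist_dist y, Real.dist_eq, abs_of_nonneg (by linarith), ← this]
    exact eVariationOn.edist_le f ⟨hx, le_rfl, hxy⟩ ⟨hy, hxy, le_rfl⟩
  intro x hx y hy
  rw [ENNReal.coe_one, one_mul]
  rcases le_total x y with h | h
  · exact key x hx y hy h
  · rw [edist_comm, edist_comm x]
    exact key y hy x hx h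

theorem _root_.HasUnitSpeedOn.congr {f g : ℝ → X} {s : Set ℝ} (hf : HasUnitSpeedOn f s)
    (h : EqOn f g s) : HasUnitSpeedOn g s := by
  intro x hx y hy
  rw [← hf hx hy]
  exact (eVariationOn.congr (h.mono inter_subset_left)).symm

theorem hasUnitSpeedOn_Icc_iff {f : ℝ → X} {a b : ℝ} :
    HasUnitSpeedOn f (Icc a b) ↔ ∀ x y, a ≤ x → x ≤ y → y ≤ b →
      eVariationOn f (Icc x y) = ENNReal.ofReal (y - x) := by
  rw [HasUnitSpeedOn, hasConstantSpeedOnWith_iff_ordered]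
  constructor
  · intro h x y hx hxy hy
    have := h (x := x) ⟨hx, hxy.trans hy⟩ (y := y) ⟨hx.trans hxy, hy⟩ hxy
    rwa [Icc_inter_Icc, max_eq_right hx, min_eq_right hy, NNReal.coe_one, one_mul] at this
  · intro h x hx y hy hxy
    rw [Icc_inter_Icc, max_eq_right hx.1, min_eq_right hy.2, NNReal.coe_one, one_mul]
    exact h x y hx.1 hxy hy.2

theorem _root_.HasUnitSpeedOn.comp_sub_right {f : ℝ → X} {a b : ℝ}
    (hf : HasUnitSpeedOn f (Icc a b)) (c : ℝ) :
    HasUnitSpeedOn (fun t => f (t - c)) (Icc (a + c) (b + c)) := by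
  rw [hasUnitSpeedOn_Icc_iff] at hf ⊢
  intro x y hx hxy hy
  have h := eVariationOn.comp_eq_of_monotoneOn f (t := Icc x y) (fun t => t - c)
    (fun s _ t _ hst => by simpa using hst)
  rw [image_sub_const_Icc, hf _ _ (by linarith) (by linarith) (by linarith)] at h
  rw [show y - x = y - c - (x - c) by ring, ← h]
  rfl

theorem _root_.HasUnitSpeedOn.comp_const_sub {f : ℝ → X} {a b : ℝ}
    (hf : HasUnitSpeedOn f (Icc a b)) (c : ℝ) :
    HasUnitSpeedOn (fun t => f (c - t)) (Icc (c - b) (c - a)) := by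
  rw [hasUnitSpeedOn_Icc_iff] at hf ⊢
  intro x y hx hxy hy
  have h := eVariationOn.comp_eq_of_antitoneOn f (t := Icc x y) (fun t => c - t)
    (fun s _ t _ hst => sub_le_sub_left hst c)
  rw [image_const_sub_Icc, hf _ _ (by linarith) (by linarith) (by linarith)] at h
  rw [show y - x = c - x - (c - y) by ring, ← h]
  rfl

theorem _root_.Isometry.hasUnitSpeedOn_Icc {f : ℝ → X} (hf : Isometry f) (a b : ℝ) :
    HasUnitSpeedOn f (Icc a b) := by
  rw [hasUnitSpeedOn_Icc_iff]
  intro x y _ hxy _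
  apply le_antisymm
  · have := (hf.lipschitz.lipschitzOnWith (s := univ)).comp_eVariationOn_le
      (f := f) (g := (id : ℝ → ℝ)) (s := Icc x y) (mapsTo_univ _ _)
    rw [eVariationOn_id_Icc, ENNReal.coe_one, one_mul] at this
    exact this
  · have := eVariationOn.edist_le f (left_mem_Icc.2 hxy) (right_mem_Icc.2 hxy)
    rw [hf.edist_eq, edist_comm, edist_dist, Real.dist_eq, abs_of_nonneg (by linarith)] at this
    exact this

end UnitSpeed

/-! ### Arclength parametrization, and concatenation of arcs with their costs. -/

section Arcs

variable {n : ℕ}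

theorem Curve.arclengthParam_spec (γ : Curve n) (hγ : γ.Rectifiable) :
    HasUnitSpeedOn γ.arclengthParam (Icc 0 γ.length.toReal) ∧
      γ.arclengthParam 0 = γ.toFun γ.a ∧
      γ.arclengthParam γ.length.toReal = γ.toFun γ.b := by
  have hbv : BoundedVariationOn γ.toFun (Icc γ.a γ.b) := hγ
  have hl := hbv.locallyBoundedVariationOn
  have ha : γ.a ∈ Icc γ.a γ.b := left_mem_Icc.2 γ.le
  have hb : γ.b ∈ Icc γ.a γ.b := right_mem_Icc.2 γ.le
  have hVa : variationOnFromTo γ.toFun (Icc γ.a γ.b) γ.a γ.a = 0 := variationOnFromTo.self _ _ _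
  have hVb : variationOnFromTo γ.toFun (Icc γ.a γ.b) γ.a γ.b = γ.length.toReal := by
    rw [variationOnFromTo.eq_of_le _ _ γ.le, inter_self]; rfl
  have himg : variationOnFromTo γ.toFun (Icc γ.a γ.b) γ.a '' Icc γ.a γ.b
      = Icc 0 γ.length.toReal := by
    have hm := variationOnFromTo.monotoneOn hl ha
    apply Subset.antisymm
    · rintro _ ⟨t, ht, rfl⟩
      exact ⟨hVa ▸ hm ha ht ht.1, hVb ▸ hm ht hb ht.2⟩
    · have := intermediate_value_Icc γ.le (continuousOn_variationOnFromTo hl ha γ.cont)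
      rwa [hVa, hVb] at this
  refine ⟨himg ▸ has_unit_speed_naturalParameterization γ.toFun hl ha, ?_, ?_⟩
  · have := edist_naturalParameterization_eq_zero hl ha ha
    rw [hVa, edist_eq_zero] at this
    exact this
  · have := edist_naturalParameterization_eq_zero hl ha hb
    rw [hVb, edist_eq_zero] at this
    exact this

/-- The curve defined by a unit speed map on `[0, L]`. -/
def Curve.ofUnitSpeed (g : ℝ → EuclideanSpace ℝ (Fin n)) (L : ℝ) (hL : 0 ≤ L)
    (hg : HasUnitSpeedOn g (Icc 0 L)) : Curve n :=
  ⟨0, L, hL, g, hg.lipschitzOnWith.continuousOn⟩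

theorem Curve.ofUnitSpeed_length {g : ℝ → EuclideanSpace ℝ (Fin n)} {L : ℝ} (hL : 0 ≤ L)
    (hg : HasUnitSpeedOn g (Icc 0 L)) :
    (Curve.ofUnitSpeed g L hL hg).length = ENNReal.ofReal L := by
  have := hasUnitSpeedOn_Icc_iff.1 hg 0 L le_rfl hL le_rfl
  rwa [sub_zero] at this

theorem Curve.ofUnitSpeed_lineIntegral {g : ℝ → EuclideanSpace ℝ (Fin n)} {L : ℝ} (hL : 0 ≤ L)
    (hg : HasUnitSpeedOn g (Icc 0 L)) (ρ : EuclideanSpace ℝ (Fin n) → ℝ≥0∞) :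
    (Curve.ofUnitSpeed g L hL hg).lineIntegral ρ = ∫⁻ t in Icc 0 L, ρ (g t) := by
  rw [Curve.lineIntegral, Curve.ofUnitSpeed_length, ENNReal.toReal_ofReal hL]
  refine setLIntegral_congr_fun measurableSet_Icc fun t ht => ?_
  have hV := (hasConstantSpeedOnWith_iff_variationOnFromTo_eq.1 hg)
  have h0 : (0 : ℝ) ∈ Icc 0 L := left_mem_Icc.2 hL
  have := edist_naturalParameterization_eq_zero hV.1 h0 ht
  rw [hV.2 h0 ht, edist_eq_zero, NNReal.coe_one, one_mul, sub_zero] at this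
  exact congrArg ρ this

/-- The points `u` and `v` are joined inside `S` by an arc along which the line integral of `ρ`
is at most `c`. -/
def JoinedBy (S : Set (EuclideanSpace ℝ (Fin n))) (ρ : EuclideanSpace ℝ (Fin n) → ℝ≥0∞)
    (u v : EuclideanSpace ℝ (Fin n)) (c : ℝ≥0∞) : Prop :=
  ∃ (g : ℝ → EuclideanSpace ℝ (Fin n)) (L : ℝ), 0 ≤ L ∧ HasUnitSpeedOn g (Icc 0 L) ∧
    g 0 = u ∧ g L = v ∧ MapsTo g (Icc 0 L) S ∧ ∫⁻ t in Icc 0 L, ρ (g t) ≤ c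

variable {S : Set (EuclideanSpace ℝ (Fin n))} {ρ : EuclideanSpace ℝ (Fin n) → ℝ≥0∞}
  {u v w : EuclideanSpace ℝ (Fin n)} {c d : ℝ≥0∞}

theorem JoinedBy.symm (h : JoinedBy S ρ u v c) : JoinedBy S ρ v u c := by
  obtain ⟨g, L, hL, hg, h0, h1, hS, hc⟩ := h
  refine ⟨fun t => g (L - t), L, hL, ?_, by simpa using h1, by simpa using h0, ?_, ?_⟩
  · simpa using hg.comp_const_sub L
  · intro t ht
    exact hS ⟨by linarith [ht.2], by linarith [ht.1]⟩
  · refine le_trans (le_of_eq ?_) hc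
    rw [← lintegral_indicator measurableSet_Icc, ← lintegral_indicator measurableSet_Icc,
      ← lintegral_sub_left_eq_self _ L]
    congr 1
    ext t
    simp only [indicator, mem_Icc, sub_sub_cancel]
    congr 1
    apply propext
    constructor <;> intro h <;> constructor <;> linarith [h.1, h.2]

theorem JoinedBy.trans (h : JoinedBy S ρ u v c) (h' : JoinedBy S ρ v w d) :
    JoinedBy S ρ u w (c + d) := by
  obtain ⟨g, L, hL, hg, h0, h1, hS, hc⟩ := h
  obtain ⟨k, M, hM, hk, k0, k1, kS, kd⟩ := h'
  have e1 : EqOn g (fun t => if t ≤ L then g t else k (t - L)) (Icc 0 L) := by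
    intro t ht
    simp [ht.2]
  have e2 : EqOn (fun t => k (t - L)) (fun t => if t ≤ L then g t else k (t - L))
      (Icc L (M + L)) := by
    intro t ht
    rcases ht.1.eq_or_lt with rfl | h
    · simp [h1, k0]
    · simp [h.not_ge]
  have hk' := hk.comp_sub_right L
  rw [zero_add] at hk'
  refine ⟨fun t => if t ≤ L then g t else k (t - L), M + L, by linarith,
    (hg.congr e1).Icc_Icc (hk'.congr e2), by simp [hL, h0], ?_, ?_, ?_⟩
  · rw [← e2 ⟨by linarith, le_rfl⟩]
    simpa using k1
  · intro t ht
    rcases le_total t L with h | h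
    · rw [← e1 ⟨ht.1, h⟩]
      exact hS ⟨ht.1, h⟩
    · rw [← e2 ⟨h, ht.2⟩]
      exact kS ⟨by linarith, by linarith [ht.2]⟩
  · rw [← Icc_union_Icc_eq_Icc hL (by linarith : L ≤ M + L)]
    refine (lintegral_union_le _ _ _).trans (add_le_add ?_ ?_)
    · rw [← setLIntegral_congr_fun measurableSet_Icc (fun t ht => congrArg ρ (e1 ht))]
      exact hc
    · rw [← setLIntegral_congr_fun measurableSet_Icc (fun t ht => congrArg ρ (e2 ht))]
      refine le_trans (le_of_eq ?_) kd
      rw [← lintegral_indicator measurableSet_Icc, ← lintegral_indicator measurableSet_Icc,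
        ← lintegral_sub_right_eq_self ((Icc 0 M).indicator fun t => ρ (k t)) L]
      congr 1
      ext t
      simp only [indicator, mem_Icc]
      congr 1
      apply propext
      constructor <;> intro h <;> constructor <;> linarith [h.1, h.2]

/-- The line integral of `ρ` along the segment from `u` to `v`. -/
noncomputable def segmentCost (ρ : EuclideanSpace ℝ (Fin n) → ℝ≥0∞)
    (u v : EuclideanSpace ℝ (Fin n)) : ℝ≥0∞ :=
  ∫⁻ s in Icc (0 : ℝ) 1, ρ (u + s • (v - u)) * ‖v - u‖ₑ

theorem joinedBy_segment (hρ : Measurable ρ) (hS : ∀ s ∈ Icc (0 : ℝ) 1, u + s • (v - u) ∈ S) :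
    JoinedBy S ρ u v (segmentCost ρ u v) := by
  -- A degenerate segment is an arc of length 0; otherwise the parameter is rescaled by the length
  -- `l` to reach unit speed.
  rcases eq_or_ne u v with rfl | huv
  · refine ⟨fun _ => u, 0, le_rfl, ?_, rfl, rfl, ?_, ?_⟩
    · exact hasConstantSpeedOnWith_of_subsingleton _ (by simp) _
    · intro t _
      simpa using hS 0 (by simp)
    · simp
  · set l := ‖v - u‖ with hl
    have hl0 : 0 < l := norm_pos_iff.2 (sub_ne_zero.2 huv.symm)
    have hiso : Isometry (fun t : ℝ => u + t • (l⁻¹ • (v - u))) := by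
      apply Isometry.of_dist_eq
      intro s t
      rw [dist_add_left, dist_eq_norm, ← sub_smul, norm_smul, norm_smul, ← hl, norm_inv,
        Real.norm_of_nonneg hl0.le, inv_mul_cancel₀ hl0.ne', mul_one, dist_eq_norm]
    refine ⟨fun t => u + t • (l⁻¹ • (v - u)), l, hl0.le, hiso.hasUnitSpeedOn_Icc _ _, by simp, ?_,
      ?_, ?_⟩
    · simp [smul_smul, mul_inv_cancel₀ hl0.ne']
    · intro t ht
      simp only [smul_smul]
      exact hS _ ⟨mul_nonneg ht.1 (inv_nonneg.2 hl0.le), by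
        rw [← div_eq_mul_inv]; exact div_le_one_of_le₀ ht.2 hl0.le⟩
    · have hF : Measurable ((Icc (0 : ℝ) l).indicator fun t => ρ (u + t • (l⁻¹ • (v - u)))) :=
        (hρ.comp (by fun_prop)).indicator measurableSet_Icc
      have hscale : ∫⁻ t, (Icc (0 : ℝ) l).indicator (fun t => ρ (u + t • (l⁻¹ • (v - u)))) t =
          ENNReal.ofReal l * ∫⁻ s, (Icc (0 : ℝ) l).indicator
            (fun t => ρ (u + t • (l⁻¹ • (v - u)))) (l * s) := by
        conv_lhs => rw [← Real.smul_map_volume_mul_left hl0.ne']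
        rw [lintegral_smul_measure, lintegral_map hF (measurable_const_mul l), abs_of_pos hl0,
          smul_eq_mul]
      rw [segmentCost, lintegral_mul_const _ (by fun_prop), ← lintegral_indicator measurableSet_Icc,
        ← lintegral_indicator measurableSet_Icc, hscale, mul_comm, ← ofReal_norm, ← hl]
      refine le_of_eq (congrArg (· * _) (lintegral_congr fun s => ?_))
      have h1 : l * s ∈ Icc 0 l ↔ s ∈ Icc (0 : ℝ) 1 := by
        simp only [mem_Icc, mul_nonneg_iff_of_pos_left hl0, mul_le_iff_le_one_right hl0]
      by_cases hs : s ∈ Icc (0 : ℝ) 1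
      · rw [indicator_of_mem hs, indicator_of_mem (h1.2 hs), smul_smul, mul_right_comm,
          mul_inv_cancel₀ hl0.ne', one_mul]
      · rw [indicator_of_notMem hs, indicator_of_notMem (fun h => hs (h1.1 h))]

end Arcs

/-! ### Null sets swept out by `E` and one real parameter. -/

section Null

open Metric

variable {n : ℕ}

theorem eventually_const_mul_lt {a b : ℝ≥0∞} (ha : a ≠ ∞) (hb : 0 < b) :
    ∀ᶠ ε in 𝓝[>] (0 : ℝ≥0∞), a * ε < b := by
  have : Tendsto (fun ε : ℝ≥0∞ => a * ε) (𝓝[>] 0) (𝓝 (a * 0)) :=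
    (ENNReal.Tendsto.const_mul tendsto_id (Or.inr ha)).mono_left nhdsWithin_le_nhds
  rw [mul_zero] at this
  exact this.eventually_lt_const hb

theorem volume_closedBall_eq (x : EuclideanSpace ℝ (Fin n)) {r : ℝ} (hr : 0 ≤ r) :
    volume (closedBall x r) =
      ENNReal.ofReal (r ^ n) * volume (ball (0 : EuclideanSpace ℝ (Fin n)) 1) := by
  have := Measure.addHaar_closedBall (volume : Measure (EuclideanSpace ℝ (Fin n))) x hr
  rwa [finrank_euclideanSpace_fin] at this

/-- Cut `[0, L]` into about `L / d` intervals of length `d`. Over each, the image lies in a ball of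
radius `2Kd`, so the total volume is of order `(L / d) dⁿ`, whence the exponent `n - 1`. -/
theorem volume_image2_le_of_dist_le {A : Set (EuclideanSpace ℝ (Fin n))}
    {Φ : EuclideanSpace ℝ (Fin n) → ℝ → EuclideanSpace ℝ (Fin n)} {K L d : ℝ} (hK : 0 ≤ K)
    (hL : 0 ≤ L) (hd : 0 < d) (hd1 : d ≤ 1) (hA : ∀ e ∈ A, ∀ e' ∈ A, dist e e' ≤ d)
    (hΦ : ∀ e ∈ A, ∀ e' ∈ A, ∀ t ∈ Icc 0 L, ∀ t' ∈ Icc 0 L,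
      dist (Φ e t) (Φ e' t') ≤ K * (dist e e' + |t - t'|)) :
    volume (image2 Φ A (Icc 0 L)) ≤
      ENNReal.ofReal ((L + 1) * (2 * K) ^ n) * volume (ball (0 : EuclideanSpace ℝ (Fin n)) 1) *
        ENNReal.ofReal d ^ ((n : ℝ) - 1) := by
  set N := ⌊L / d⌋₊ + 1 with hN
  have hcov : image2 Φ A (Icc 0 L) ⊆
      ⋃ j ∈ Finset.range N, image2 Φ A (Icc 0 L ∩ Icc (j * d) ((j + 1) * d)) := by
    rintro _ ⟨e, he, t, ht, rfl⟩
    have htd : 0 ≤ t / d := div_nonneg ht.1 hd.le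
    refine mem_biUnion (x := ⌊t / d⌋₊) ?_ ⟨e, he, t, ⟨ht, ?_, ?_⟩, rfl⟩
    · simp only [Finset.coe_range, mem_Iio, hN, Nat.lt_succ_iff]
      exact Nat.floor_mono (div_le_div_of_nonneg_right ht.2 hd.le)
    · exact (le_div_iff₀ hd).1 (Nat.floor_le htd)
    · exact (div_le_iff₀ hd).1 (Nat.lt_floor_add_one _).le
  have hpiece : ∀ j ∈ Finset.range N,
      volume (image2 Φ A (Icc 0 L ∩ Icc (j * d) ((j + 1) * d))) ≤
        ENNReal.ofReal ((K * (2 * d)) ^ n) * volume (ball (0 : EuclideanSpace ℝ (Fin n)) 1) := by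
    intro j _
    rcases (image2 Φ A (Icc 0 L ∩ Icc (j * d) ((j + 1) * d))).eq_empty_or_nonempty with h | h
    · simp [h]
    · obtain ⟨_, e, he, t, ht, rfl⟩ := h
      rw [← volume_closedBall_eq (Φ e t) (by positivity)]
      apply measure_mono
      rintro _ ⟨e', he', t', ht', rfl⟩
      refine (hΦ e' he' e he t' ht'.1 t ht.1).trans (mul_le_mul_of_nonneg_left ?_ hK)
      have h1 := hA e' he' e he
      have h2 : |t' - t| ≤ d := by
        rw [abs_le]
        constructor <;> linarith [ht.2.1, ht.2.2, ht'.2.1, ht'.2.2]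
      linarith
  refine (measure_mono hcov).trans ((measure_biUnion_finset_le _ _).trans
    ((Finset.sum_le_sum hpiece).trans ?_))
  rw [Finset.sum_const, Finset.card_range, nsmul_eq_mul, mul_right_comm, ← mul_assoc]
  refine mul_le_mul_left ?_ _
  rw [ENNReal.ofReal_rpow_of_pos hd, ← ENNReal.ofReal_natCast, ← ENNReal.ofReal_mul (by positivity),
    ← ENNReal.ofReal_mul (by positivity)]
  apply ENNReal.ofReal_le_ofReal
  rw [Real.rpow_sub_one hd.ne', Real.rpow_natCast]
  have h1 : (N : ℝ) ≤ (L + 1) / d := by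
    rw [hN, Nat.cast_add, Nat.cast_one, add_div]
    exact add_le_add (Nat.floor_le (div_nonneg hL hd.le)) ((one_le_div hd).2 hd1)
  calc (N : ℝ) * (K * (2 * d)) ^ n ≤ (L + 1) / d * (K * (2 * d)) ^ n := by gcongr
    _ = (L + 1) * (2 * K) ^ n * (d ^ n / d) := by
      rw [show K * (2 * d) = (2 * K) * d by ring, mul_pow]; ring

/-- The diameter may be zero, so the previous bound is used for `d` slightly above it and `d` then
decreases; the bound `1 / 2` leaves room for `d ≤ 1`. -/
theorem volume_image2_le_ediam {A : Set (EuclideanSpace ℝ (Fin n))}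
    {Φ : EuclideanSpace ℝ (Fin n) → ℝ → EuclideanSpace ℝ (Fin n)} {K L : ℝ} (hK : 0 ≤ K)
    (hL : 0 ≤ L) (hA : ediam A ≤ 1 / 2)
    (hΦ : ∀ e ∈ A, ∀ e' ∈ A, ∀ t ∈ Icc 0 L, ∀ t' ∈ Icc 0 L,
      dist (Φ e t) (Φ e' t') ≤ K * (dist e e' + |t - t'|)) :
    volume (image2 Φ A (Icc 0 L)) ≤
      ENNReal.ofReal ((L + 1) * (2 * K) ^ n) * volume (ball (0 : EuclideanSpace ℝ (Fin n)) 1) *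
        ediam A ^ ((n : ℝ) - 1) := by
  have hfin : ediam A ≠ ∞ := ne_top_of_le_ne_top (by simp) hA
  have hlt : (ediam A).toReal < 1 := by
    have h2 := ENNReal.toReal_mono (by simp) hA
    rw [ENNReal.toReal_div] at h2
    norm_num at h2
    linarith
  have htend : Tendsto (fun d : ℝ => ENNReal.ofReal ((L + 1) * (2 * K) ^ n) *
      volume (ball (0 : EuclideanSpace ℝ (Fin n)) 1) * ENNReal.ofReal d ^ ((n : ℝ) - 1))
      (𝓝[>] (ediam A).toReal) (𝓝 (ENNReal.ofReal ((L + 1) * (2 * K) ^ n) *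
      volume (ball (0 : EuclideanSpace ℝ (Fin n)) 1) *
        ENNReal.ofReal (ediam A).toReal ^ ((n : ℝ) - 1))) := by
    apply Tendsto.mono_left _ nhdsWithin_le_nhds
    refine ENNReal.Tendsto.const_mul ?_ (Or.inr ?_)
    · exact ((ENNReal.continuous_rpow_const.comp ENNReal.continuous_ofReal).tendsto _)
    · exact ENNReal.mul_ne_top ENNReal.ofReal_ne_top measure_ball_lt_top.ne
  rw [ENNReal.ofReal_toReal hfin] at htend
  refine ge_of_tendsto htend ?_
  filter_upwards [Ioc_mem_nhdsGT hlt] with d hd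
  refine volume_image2_le_of_dist_le hK hL (ENNReal.toReal_nonneg.trans_lt hd.1) hd.2
    (fun e he e' he' => ?_) hΦ
  rw [dist_edist]
  exact (ENNReal.toReal_mono hfin (edist_le_ediam_of_mem he he')).trans hd.1.le

theorem volume_image2_eq_zero (hn : 2 ≤ n) {E : Set (EuclideanSpace ℝ (Fin n))}
    (hE : Measure.hausdorffMeasure ((n : ℝ) - 1) E = 0)
    {Φ : EuclideanSpace ℝ (Fin n) → ℝ → EuclideanSpace ℝ (Fin n)} {K L : ℝ} (hK : 0 ≤ K)
    (hL : 0 ≤ L) (hΦ : ∀ e ∈ E, ∀ e' ∈ E, ∀ t ∈ Icc 0 L, ∀ t' ∈ Icc 0 L,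
      dist (Φ e t) (Φ e' t') ≤ K * (dist e e' + |t - t'|)) :
    volume (image2 Φ E (Icc 0 L)) = 0 := by
  set C := ENNReal.ofReal ((L + 1) * (2 * K) ^ n) *
    volume (ball (0 : EuclideanSpace ℝ (Fin n)) 1) with hC
  have hCfin : C ≠ ∞ := ENNReal.mul_ne_top ENNReal.ofReal_ne_top measure_ball_lt_top.ne
  have hp : (0 : ℝ) < (n : ℝ) - 1 := by
    have : (2 : ℝ) ≤ n := by exact_mod_cast hn
    linarith
  have hcover : ∀ ε : ℝ≥0∞, 0 < ε → volume (image2 Φ E (Icc 0 L)) ≤ C * ε := by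
    intro ε hε
    rw [Measure.hausdorffMeasure_apply] at hE
    simp only [ENNReal.iSup_eq_zero] at hE
    have h := hE (1 / 2) (by simp)
    have h' := (h.symm ▸ hε : _ < ε)
    simp only [iInf_lt_iff] at h'
    obtain ⟨t, ht, htd, hsum⟩ := h'
    have hsub : image2 Φ E (Icc 0 L) ⊆ ⋃ i, image2 Φ (t i ∩ E) (Icc 0 L) := by
      rintro _ ⟨e, he, s, hs, rfl⟩
      obtain ⟨i, hi⟩ := mem_iUnion.1 (ht he)
      exact mem_iUnion.2 ⟨i, e, ⟨hi, he⟩, s, hs, rfl⟩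
    refine (measure_mono hsub).trans ((measure_iUnion_le _).trans ?_)
    refine le_trans (ENNReal.tsum_le_tsum fun i => ?_)
      ((ENNReal.tsum_mul_left (a := C)).le.trans (mul_le_mul_right hsum.le C))
    rcases (t i ∩ E).eq_empty_or_nonempty with h0 | h0
    · simp [h0]
    · rw [iSup_pos h0.left]
      have hm : ediam (t i ∩ E) ≤ ediam (t i) := ediam_mono inter_subset_left
      refine (volume_image2_le_ediam hK hL (hm.trans (htd i)) fun e he e' he' =>
        hΦ e he.2 e' he'.2).trans (mul_le_mul_right (ENNReal.rpow_le_rpow hm hp.le) _)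
  by_contra hne
  have hpos : 0 < volume (image2 Φ E (Icc 0 L)) := pos_iff_ne_zero.2 hne
  obtain ⟨ε, hlt, hε⟩ := ((eventually_const_mul_lt hCfin hpos).and self_mem_nhdsWithin).exists
  exact absurd (hcover ε hε) (not_le.2 hlt)

/-- Almost every translate of a Lipschitz arc avoids a set of vanishing codimension one
Hausdorff measure. -/
theorem ae_translate_notMem (hn : 2 ≤ n) {E : Set (EuclideanSpace ℝ (Fin n))}
    (hE : Measure.hausdorffMeasure ((n : ℝ) - 1) E = 0) {g : ℝ → EuclideanSpace ℝ (Fin n)} {L : ℝ}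
    (hL : 0 ≤ L) (hg : LipschitzOnWith 1 g (Icc 0 L)) :
    ∀ᵐ x, ∀ t ∈ Icc 0 L, g t + x ∉ E := by
  have h := volume_image2_eq_zero hn hE (Φ := fun e t => e - g t) zero_le_one hL
    (fun e _ e' _ t ht t' ht' => by
      have := hg.dist_le_mul t ht t' ht'
      rw [NNReal.coe_one, one_mul, Real.dist_eq] at this
      rw [one_mul]
      exact (dist_sub_sub_le _ _ _ _).trans (by linarith))
  refine measure_mono_null ?_ h
  intro x hx
  simp only [mem_compl_iff, mem_ofPred_eq, not_forall, not_not] at hx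
  obtain ⟨t, ht, hx⟩ := hx
  exact ⟨_, hx, t, ht, by simp⟩

/-- Almost every segment issuing from a point avoids a set of vanishing codimension one
Hausdorff measure, except possibly at that point. -/
theorem ae_segment_notMem (hn : 2 ≤ n) {E : Set (EuclideanSpace ℝ (Fin n))}
    (hE : Measure.hausdorffMeasure ((n : ℝ) - 1) E = 0) (u : EuclideanSpace ℝ (Fin n)) :
    ∀ᵐ y, ∀ s ∈ Ioc (0 : ℝ) 1, u + s • (y - u) ∉ E := by
  -- If `u + s(y - u) = e`, then `y = u + s⁻¹(e - u)`. Both `s⁻¹` and `e` are unbounded, so the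
  -- Lipschitz bound is obtained on an exhaustion by `m`.
  have h : ∀ m : ℕ, volume (image2 (fun e t => u + t • (e - u)) (E ∩ closedBall u m)
      (Icc 0 (m : ℝ))) = 0 := by
    intro m
    refine volume_image2_eq_zero hn (K := m) (measure_mono_null inter_subset_left hE)
      (Nat.cast_nonneg _) (Nat.cast_nonneg _) fun e he e' he' t ht t' ht' => ?_
    rw [dist_add_left, dist_eq_norm,
      show t • (e - u) - t' • (e' - u) = t' • (e - e') + (t - t') • (e - u) by module]
    refine (norm_add_le _ _).trans ?_
    rw [norm_smul, norm_smul, mul_add, Real.norm_of_nonneg ht'.1, ← dist_eq_norm e,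
      ← dist_eq_norm e, mul_comm ‖t - t'‖, Real.norm_eq_abs]
    exact add_le_add (mul_le_mul_of_nonneg_right ht'.2 dist_nonneg)
      (mul_le_mul_of_nonneg_right he.2 (abs_nonneg _))
  refine measure_mono_null ?_ (measure_iUnion_null h)
  intro y hy
  simp only [mem_compl_iff, mem_ofPred_eq, not_forall, not_not] at hy
  obtain ⟨s, hs, hy⟩ := hy
  obtain ⟨m, hm⟩ := exists_nat_ge (max (dist (u + s • (y - u)) u) s⁻¹)
  refine mem_iUnion.2 ⟨m, _, ⟨hy, (le_max_left _ _).trans hm⟩, s⁻¹,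
    ⟨inv_nonneg.2 hs.1.le, (le_max_right _ _).trans hm⟩, ?_⟩
  simp [smul_smul, inv_mul_cancel₀ hs.1.ne']

end Null

/-! ### Abundance of good points, by Vitali coverings. -/

section GoodPoints

open Metric

variable {n : ℕ}

/-- The mass of `f` on the balls centred at `u` of radius at most `R` decays linearly. -/
def IsGoodPoint (f : EuclideanSpace ℝ (Fin n) → ℝ≥0∞) (R : ℝ) (η : ℝ≥0∞)
    (u : EuclideanSpace ℝ (Fin n)) : Prop :=
  ∀ s ∈ Ioc (0 : ℝ) 1, ∫⁻ x in closedBall u (s * R), f x ≤ η * ENNReal.ofReal s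

/-- The points that are not good are covered by balls with small total radius. -/
theorem exists_cover_not_isGoodPoint (f : EuclideanSpace ℝ (Fin n) → ℝ≥0∞)
    (p : EuclideanSpace ℝ (Fin n)) {R : ℝ} (hR : 0 < R) (η : ℝ≥0∞) :
    ∃ T : Set (EuclideanSpace ℝ (Fin n) × ℝ), T.Countable ∧ (∀ a ∈ T, 0 < a.2 ∧ a.2 ≤ 2 * R) ∧
      {u ∈ closedBall p R | ¬ IsGoodPoint f (2 * R) η u} ⊆ ⋃ a ∈ T, closedBall a.1 (5 * a.2) ∧
      η * ∑' a : T, ENNReal.ofReal a.1.2 ≤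
        ENNReal.ofReal (2 * R) * ∫⁻ x in closedBall p (3 * R), f x := by
  have hR2 : 0 < 2 * R := by linarith
  let t : Set (EuclideanSpace ℝ (Fin n) × ℝ) := {a | a.1 ∈ closedBall p R ∧
    ∃ s ∈ Ioc (0 : ℝ) 1, a.2 = s * (2 * R) ∧
      η * ENNReal.ofReal s < ∫⁻ x in closedBall a.1 (s * (2 * R)), f x}
  have ht : ∀ a ∈ t, 0 < a.2 ∧ a.2 ≤ 2 * R := by
    rintro a ⟨-, s, hs, h, -⟩
    rw [h]
    exact ⟨mul_pos hs.1 hR2, mul_le_of_le_one_left hR2.le hs.2⟩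
  obtain ⟨T, hTt, hdisj, hcov⟩ := Vitali.exists_disjoint_subfamily_covering_enlargement_closedBall
    t Prod.fst Prod.snd (2 * R) (fun a ha => (ht a ha).2) 5 (by norm_num)
  have hTc : T.Countable := by
    refine hdisj.countable_of_nonempty_interior fun a ha => ?_
    exact ⟨a.1, ball_subset_interior_closedBall (mem_ball_self (ht a (hTt ha)).1)⟩
  refine ⟨T, hTc, fun a ha => ht a (hTt ha), ?_, ?_⟩
  · rintro u ⟨hu, hbad⟩
    simp only [IsGoodPoint, not_forall, not_le] at hbad
    obtain ⟨s, hs, hlt⟩ := hbad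
    obtain ⟨b, hb, hsub⟩ := hcov (u, s * (2 * R)) ⟨hu, s, hs, rfl, hlt⟩
    exact mem_biUnion hb (hsub (mem_closedBall_self (mul_pos hs.1 hR2).le))
  -- A selected ball of radius `r = s · 2R` violates goodness, so `η r` is at most `2R` times its
  -- mass. The balls are disjoint and lie in `closedBall p (3R)`: centres within `R` of `p`, radii
  -- at most `2R`.
  · calc η * ∑' a : T, ENNReal.ofReal a.1.2
        = ∑' a : T, η * ENNReal.ofReal a.1.2 := ENNReal.tsum_mul_left.symm
      _ ≤ ∑' a : T, ENNReal.ofReal (2 * R) * ∫⁻ x in closedBall a.1.1 a.1.2, f x := by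
          refine ENNReal.tsum_le_tsum fun a => ?_
          obtain ⟨-, s, hs, h, hlt⟩ := hTt a.2
          rw [h, ENNReal.ofReal_mul hs.1.le, ← mul_assoc, mul_comm (ENNReal.ofReal (2 * R))]
          exact mul_le_mul_left hlt.le _
      _ = ENNReal.ofReal (2 * R) * ∑' a : T, ∫⁻ x in closedBall a.1.1 a.1.2, f x :=
          ENNReal.tsum_mul_left
      _ = ENNReal.ofReal (2 * R) * ∫⁻ x in ⋃ a ∈ T, closedBall a.1 a.2, f x := by
          rw [lintegral_biUnion hTc (fun _ _ => measurableSet_closedBall) hdisj]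
      _ ≤ _ := by
          refine mul_le_mul_right (lintegral_mono_set (iUnion₂_subset fun a ha => ?_)) _
          apply closedBall_subset_closedBall'
          have h1 := (ht a (hTt ha)).2
          have h2 : dist a.1 p ≤ R := (hTt ha).1
          linarith

/-- As the radii `r` are at most `2R`, `(5r)ⁿ ≤ 5ⁿ (2R)ⁿ⁻¹ r`, so the bound on the total radius also
bounds the volume; `10ⁿ = 5ⁿ · 2ⁿ`. -/
theorem mul_volume_not_isGoodPoint_le (hn : n ≠ 0) (f : EuclideanSpace ℝ (Fin n) → ℝ≥0∞)
    (p : EuclideanSpace ℝ (Fin n)) {R : ℝ} (hR : 0 < R) (η : ℝ≥0∞) :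
    η * volume {u ∈ closedBall p R | ¬ IsGoodPoint f (2 * R) η u} ≤
      10 ^ n * (∫⁻ x in closedBall p (3 * R), f x) * volume (closedBall p R) := by
  obtain ⟨T, hTc, hT, hcov, hsum⟩ := exists_cover_not_isGoodPoint f p hR η
  set ω := volume (ball (0 : EuclideanSpace ℝ (Fin n)) 1)
  have hball : ∀ a : T, volume (closedBall a.1.1 (5 * a.1.2)) ≤
      ENNReal.ofReal a.1.2 * (5 ^ n * ENNReal.ofReal ((2 * R) ^ (n - 1)) * ω) := by
    intro a
    obtain ⟨h0, h1⟩ := hT a a.2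
    rw [volume_closedBall_eq _ (by positivity), ← mul_assoc]
    refine mul_le_mul_left ?_ _
    rw [show (5 : ℝ≥0∞) ^ n = ENNReal.ofReal (5 ^ n) by
      rw [ENNReal.ofReal_pow (by norm_num)]; norm_num, ← ENNReal.ofReal_mul (by positivity),
      ← ENNReal.ofReal_mul h0.le]
    apply ENNReal.ofReal_le_ofReal
    calc (5 * a.1.2) ^ n = a.1.2 * (5 ^ n * a.1.2 ^ (n - 1)) := by
          rw [mul_pow, ← mul_pow_sub_one hn a.1.2]; ring
      _ ≤ _ := by gcongr
  calc η * volume {u ∈ closedBall p R | ¬ IsGoodPoint f (2 * R) η u}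
      ≤ η * ∑' a : T, volume (closedBall a.1.1 (5 * a.1.2)) :=
        mul_le_mul_right ((measure_mono hcov).trans (measure_biUnion_le _ hTc _)) _
    _ ≤ η * ∑' a : T, ENNReal.ofReal a.1.2 * (5 ^ n * ENNReal.ofReal ((2 * R) ^ (n - 1)) * ω) :=
        mul_le_mul_right (ENNReal.tsum_le_tsum hball) _
    _ = (η * ∑' a : T, ENNReal.ofReal a.1.2) * (5 ^ n * ENNReal.ofReal ((2 * R) ^ (n - 1)) * ω) := by
        rw [ENNReal.tsum_mul_right, ← mul_assoc η]
    _ ≤ (ENNReal.ofReal (2 * R) * ∫⁻ x in closedBall p (3 * R), f x) *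
        (5 ^ n * ENNReal.ofReal ((2 * R) ^ (n - 1)) * ω) := mul_le_mul_left hsum _
    _ = _ := by
        have h10 : (10 : ℝ≥0∞) ^ n * ENNReal.ofReal (R ^ n) =
            5 ^ n * (ENNReal.ofReal (2 * R) * ENNReal.ofReal ((2 * R) ^ (n - 1))) := by
          rw [← ENNReal.ofReal_mul (by positivity), mul_pow_sub_one hn, mul_pow,
            ENNReal.ofReal_mul (by positivity), ENNReal.ofReal_pow zero_le_two,
            ENNReal.ofReal_ofNat, ← mul_assoc, ← mul_pow]
          norm_num
        rw [volume_closedBall_eq _ hR.le, mul_right_comm (10 ^ n), ← mul_assoc (10 ^ n), h10]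
        ring

/-- Distance to `p` takes every value in `[0, R]` on `F`. If all points of `F` in the ball were bad,
the projected covering balls would cover `[0, R]` by intervals of total length `10 ∑ r`, which is
too short; `20` is `10` times the `2` of `2R`. -/
theorem exists_isGoodPoint_of_isPreconnected (f : EuclideanSpace ℝ (Fin n) → ℝ≥0∞)
    {p : EuclideanSpace ℝ (Fin n)} {R : ℝ} (hR : 0 < R) {η : ℝ≥0∞}
    (hη : 20 * ∫⁻ x in closedBall p (3 * R), f x < η) {F : Set (EuclideanSpace ℝ (Fin n))}
    (hF : IsPreconnected F) (hp : p ∈ F) {z : EuclideanSpace ℝ (Fin n)} (hz : z ∈ F)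
    (hpz : R ≤ dist z p) :
    ∃ w ∈ F, w ∈ closedBall p R ∧ IsGoodPoint f (2 * R) η w := by
  by_contra! hcon
  obtain ⟨T, hTc, hT, hcov, hsum⟩ := exists_cover_not_isGoodPoint f p hR η
  have hsub : Icc 0 R ⊆ ⋃ a ∈ T, closedBall (dist a.1 p) (5 * a.2) := by
    intro t ht
    obtain ⟨w, hw, rfl⟩ := hF.intermediate_value hp hz (f := fun x => dist x p)
      (by fun_prop) (show t ∈ Icc (dist p p) (dist z p) from ⟨by simpa using ht.1, ht.2.trans hpz⟩)
    have hwR : w ∈ closedBall p R := ht.2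
    obtain ⟨a, ha, hwa⟩ := mem_iUnion₂.1 (hcov ⟨hwR, hcon w hw hwR⟩)
    refine mem_biUnion ha ?_
    exact (abs_dist_sub_le w a.1 p).trans hwa
  have h1 : ENNReal.ofReal R ≤ 10 * ∑' a : T, ENNReal.ofReal a.1.2 := by
    calc ENNReal.ofReal R = volume (Icc 0 R) := by rw [Real.volume_Icc, sub_zero]
      _ ≤ ∑' a : T, volume (closedBall (dist a.1.1 p) (5 * a.1.2)) :=
        (measure_mono hsub).trans (measure_biUnion_le _ hTc _)
      _ = ∑' a : T, 10 * ENNReal.ofReal a.1.2 := by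
        refine tsum_congr fun a => ?_
        rw [Real.volume_closedBall, show 2 * (5 * a.1.2) = 10 * a.1.2 by ring,
          ENNReal.ofReal_mul (by norm_num)]
        norm_num
      _ = _ := ENNReal.tsum_mul_left
  have h2 : ENNReal.ofReal R * η ≤
      ENNReal.ofReal R * (20 * ∫⁻ x in closedBall p (3 * R), f x) := by
    calc ENNReal.ofReal R * η ≤ (10 * ∑' a : T, ENNReal.ofReal a.1.2) * η := mul_le_mul_left h1 _
      _ = 10 * (η * ∑' a : T, ENNReal.ofReal a.1.2) := by ring
      _ ≤ 10 * (ENNReal.ofReal (2 * R) * ∫⁻ x in closedBall p (3 * R), f x) :=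
          mul_le_mul_right hsum _
      _ = _ := by
          rw [ENNReal.ofReal_mul (by norm_num), ENNReal.ofReal_ofNat]
          ring
  rw [ENNReal.mul_le_mul_iff_right (ENNReal.ofReal_pos.2 hR).ne' ENNReal.ofReal_ne_top] at h2
  exact absurd h2 (not_le.2 hη)

end GoodPoints

/-! ### Mean cost of segments and cheap connections between good points. -/

section Averages

open Metric ProbabilityTheory

variable {n : ℕ}

theorem rpow_lintegral_le {α : Type*} [MeasurableSpace α] (μ : Measure α) [IsProbabilityMeasure μ]
    {f : α → ℝ≥0∞} (hf : Measurable f) {p : ℝ} (hp : 1 < p) :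
    (∫⁻ x, f x ∂μ) ^ p ≤ ∫⁻ x, f x ^ p ∂μ := by
  have h := ENNReal.lintegral_mul_le_Lp_mul_Lq μ (Real.HolderConjugate.conjExponent hp)
    hf.aemeasurable (aemeasurable_const (b := (1 : ℝ≥0∞)))
  simp only [Pi.mul_apply, mul_one, ENNReal.one_rpow, lintegral_const, measure_univ] at h
  have := ENNReal.rpow_le_rpow h (zero_le_one.trans hp.le)
  rwa [← ENNReal.rpow_mul, one_div, inv_mul_cancel₀ (by linarith), ENNReal.rpow_one] at this

theorem lintegral_le_rpow {α : Type*} [MeasurableSpace α] (μ : Measure α) [IsProbabilityMeasure μ]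
    {f : α → ℝ≥0∞} (hf : Measurable f) {p : ℝ} (hp : 1 < p) :
    ∫⁻ x, f x ∂μ ≤ (∫⁻ x, f x ^ p ∂μ) ^ p⁻¹ := by
  rw [ENNReal.le_rpow_inv_iff (by linarith)]
  exact rpow_lintegral_le μ hf hp

theorem volume_closedBall_pos (p : EuclideanSpace ℝ (Fin n)) {R : ℝ} (hR : 0 < R) :
    0 < volume (closedBall p R) :=
  (measure_ball_pos _ _ hR).trans_le (measure_mono ball_subset_closedBall)

theorem isProbabilityMeasure_cond_closedBall (p : EuclideanSpace ℝ (Fin n)) {R : ℝ} (hR : 0 < R) :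
    IsProbabilityMeasure (cond volume (closedBall p R)) :=
  cond_isProbabilityMeasure_of_finite (volume_closedBall_pos p hR).ne' measure_closedBall_lt_top.ne

theorem setLIntegral_comp_homothety {f : EuclideanSpace ℝ (Fin n) → ℝ≥0∞} (hf : Measurable f)
    (u : EuclideanSpace ℝ (Fin n)) (R : ℝ) {s : ℝ} (hs : 0 < s) :
    ∫⁻ y in closedBall u R, f (u + s • (y - u)) =
      ENNReal.ofReal (s ^ n)⁻¹ * ∫⁻ x in closedBall u (s * R), f x := by
  rw [← lintegral_indicator measurableSet_closedBall, ← lintegral_indicator measurableSet_closedBall]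
  set F := (closedBall u (s * R)).indicator f with hF
  have hFm : Measurable F := hf.indicator measurableSet_closedBall
  have h1 : ∀ y, (closedBall u R).indicator (fun y => f (u + s • (y - u))) y =
      F (s • y + (u - s • u)) := by
    intro y
    have he : s • y + (u - s • u) = u + s • (y - u) := by module
    have hm : u + s • (y - u) ∈ closedBall u (s * R) ↔ y ∈ closedBall u R := by
      rw [mem_closedBall, mem_closedBall, dist_self_add_left, norm_smul, Real.norm_of_nonneg hs.le,
        ← dist_eq_norm, mul_le_mul_iff_right₀ hs]
    rw [he, hF]
    by_cases hy : y ∈ closedBall u R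
    · rw [indicator_of_mem hy, indicator_of_mem (hm.2 hy)]
    · rw [indicator_of_notMem hy, indicator_of_notMem (fun h => hy (hm.1 h))]
  have h2 : ∫⁻ y, F (s • y + (u - s • u)) =
      ∫⁻ x, F (x + (u - s • u)) ∂(Measure.map (s • ·) volume) := by
    rw [lintegral_map (by fun_prop) (by fun_prop)]
  rw [lintegral_congr h1, h2, Measure.map_addHaar_smul _ hs.ne', lintegral_smul_measure,
    lintegral_add_right_eq_self F, finrank_euclideanSpace_fin, abs_of_pos (by positivity),
    smul_eq_mul]

theorem measurable_segmentCost {ρ : EuclideanSpace ℝ (Fin n) → ℝ≥0∞} (hρ : Measurable ρ)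
    (u : EuclideanSpace ℝ (Fin n)) : Measurable (segmentCost ρ u) := by
  unfold segmentCost
  apply Measurable.lintegral_prod_right'
    (f := fun z : EuclideanSpace ℝ (Fin n) × ℝ => ρ (u + z.2 • (z.1 - u)) * ‖z.1 - u‖ₑ)
  fun_prop

/-- The constant in the bound for the mean cost of segments issuing from a good point. -/
noncomputable def segmentConst (n : ℕ) : ℝ≥0∞ :=
  (volume (ball (0 : EuclideanSpace ℝ (Fin n)) 1))⁻¹ ^ (n : ℝ)⁻¹ *
    ∫⁻ s in Ioc (0 : ℝ) 1, ENNReal.ofReal (s ^ ((n : ℝ)⁻¹ - 1))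

theorem segmentConst_ne_top (hn : 2 ≤ n) : segmentConst n ≠ ∞ := by
  refine ENNReal.mul_ne_top (ENNReal.rpow_ne_top_of_nonneg (by positivity) ?_) ?_
  · exact ENNReal.inv_ne_top.2 (measure_ball_pos _ _ one_pos).ne'
  · have h : IntegrableOn (fun s : ℝ => s ^ ((n : ℝ)⁻¹ - 1)) (Ioc 0 1) := by
      rw [← intervalIntegrable_iff_integrableOn_Ioc_of_le zero_le_one]
      apply intervalIntegral.intervalIntegrable_rpow'
      have : (0 : ℝ) < (n : ℝ)⁻¹ := by positivity
      linarith
    exact h.lintegral_lt_top.ne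

/-- At fraction `s` of the segments, Hölder's inequality on the ball of radius `sR`, whose mass is
at most `ηs`, bounds the mean by a multiple of `η^(1/n) s^(1/n - 1)`; the powers of `R` cancel. The
linear decay makes this integrable at `s = 0`. -/
theorem lintegral_segmentCost_le (hn : 2 ≤ n) {ρ : EuclideanSpace ℝ (Fin n) → ℝ≥0∞}
    (hρ : Measurable ρ) {u : EuclideanSpace ℝ (Fin n)} {R : ℝ} (hR : 0 < R) {η : ℝ≥0∞}
    (hu : IsGoodPoint (fun x => ρ x ^ (n : ℝ)) R η u) :
    ∫⁻ y, segmentCost ρ u y ∂(cond volume (closedBall u R)) ≤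
      segmentConst n * η ^ (n : ℝ)⁻¹ := by
  have := isProbabilityMeasure_cond_closedBall u hR
  have hn1 : (1 : ℝ) < n := by exact_mod_cast (by omega : 1 < n)
  have hn0 : (0 : ℝ) ≤ (n : ℝ)⁻¹ := by positivity
  set ω := volume (ball (0 : EuclideanSpace ℝ (Fin n)) 1) with hω
  have hω0 : ω ≠ 0 := (measure_ball_pos _ _ one_pos).ne'
  have hωt : ω ≠ ∞ := measure_ball_lt_top.ne
  have hinner : ∀ s ∈ Ioc (0 : ℝ) 1,
      ∫⁻ y, ρ (u + s • (y - u)) * ‖y - u‖ₑ ∂(cond volume (closedBall u R)) ≤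
        ω⁻¹ ^ (n : ℝ)⁻¹ * η ^ (n : ℝ)⁻¹ * ENNReal.ofReal (s ^ ((n : ℝ)⁻¹ - 1)) := by
    intro s hs
    have h1 : ∫⁻ y, ρ (u + s • (y - u)) * ‖y - u‖ₑ ∂(cond volume (closedBall u R)) ≤
        (∫⁻ y, ρ (u + s • (y - u)) ∂(cond volume (closedBall u R))) * ENNReal.ofReal R := by
      rw [← lintegral_mul_const _ (by fun_prop)]
      apply lintegral_mono_ae
      rw [ProbabilityTheory.cond]
      apply Measure.ae_smul_measure
      filter_upwards [ae_restrict_mem measurableSet_closedBall] with y hy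
      rw [← ofReal_norm, ← dist_eq_norm]
      exact mul_le_mul_right (ENNReal.ofReal_le_ofReal hy) _
    have h2 := lintegral_le_rpow (cond volume (closedBall u R))
      (f := fun y => ρ (u + s • (y - u))) (by fun_prop) hn1
    have h3 : ∫⁻ y, ρ (u + s • (y - u)) ^ (n : ℝ) ∂(cond volume (closedBall u R)) ≤
        ω⁻¹ * η * ENNReal.ofReal (s ^ (1 - (n : ℝ)) * R ^ (-(n : ℝ))) := by
      rw [ProbabilityTheory.cond, lintegral_smul_measure, smul_eq_mul,
        setLIntegral_comp_homothety (f := fun x => ρ x ^ (n : ℝ)) (by fun_prop) u R hs.1,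
        volume_closedBall_eq _ hR.le]
      refine (mul_le_mul_right (mul_le_mul_right (hu s hs) _) _).trans (le_of_eq ?_)
      rw [ENNReal.mul_inv (Or.inr hωt) (Or.inr hω0), ← ENNReal.ofReal_inv_of_pos (by positivity),
        Real.rpow_sub hs.1, Real.rpow_neg hR.le, Real.rpow_one, Real.rpow_natCast,
        Real.rpow_natCast, ENNReal.ofReal_mul (div_nonneg hs.1.le (pow_nonneg hs.1.le _)),
        div_eq_mul_inv, ENNReal.ofReal_mul hs.1.le]
      ring
    refine h1.trans ((mul_le_mul_left (h2.trans (ENNReal.rpow_le_rpow h3 hn0)) _).trans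
      (le_of_eq ?_))
    rw [ENNReal.mul_rpow_of_nonneg _ _ hn0, ENNReal.mul_rpow_of_nonneg _ _ hn0, mul_assoc,
      ENNReal.ofReal_rpow_of_nonneg (by have := hs.1.le; positivity) hn0,
      ← ENNReal.ofReal_mul (by have := hs.1.le; positivity),
      Real.mul_rpow (by have := hs.1.le; positivity) (by positivity), ← Real.rpow_mul hs.1.le,
      ← Real.rpow_mul hR.le]
    congr 2
    rw [neg_mul, mul_inv_cancel₀ (by linarith), Real.rpow_neg_one, mul_assoc,
      inv_mul_cancel₀ hR.ne', mul_one, sub_mul, one_mul, mul_inv_cancel₀ (by linarith)]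
  unfold segmentCost
  -- The pointwise bound is available only for `s > 0`, so the null endpoint is dropped.
  rw [lintegral_lintegral_swap (by fun_prop), Measure.restrict_congr_set Ioc_ae_eq_Icc.symm]
  refine (setLIntegral_mono' measurableSet_Ioc hinner).trans (le_of_eq ?_)
  rw [lintegral_const_mul _ (by fun_prop), segmentConst]
  ring

theorem lintegral_cond_le_of_dist_le (f : EuclideanSpace ℝ (Fin n) → ℝ≥0∞)
    {p u : EuclideanSpace ℝ (Fin n)} {R : ℝ} (hR : 0 < R) (hu : u ∈ closedBall p R) :
    ∫⁻ y, f y ∂(cond volume (closedBall p R)) ≤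
      2 ^ n * ∫⁻ y, f y ∂(cond volume (closedBall u (2 * R))) := by
  have hvol : volume (closedBall u (2 * R)) = 2 ^ n * volume (closedBall p R) := by
    rw [volume_closedBall_eq _ hR.le, volume_closedBall_eq _ (by linarith), mul_pow,
      ENNReal.ofReal_mul (by positivity), ENNReal.ofReal_pow (by norm_num), ENNReal.ofReal_ofNat,
      mul_assoc]
  have h2 : (2 : ℝ≥0∞) ^ n ≠ 0 := pow_ne_zero _ (by norm_num)
  have h2' : (2 : ℝ≥0∞) ^ n ≠ ∞ := ENNReal.pow_ne_top (by norm_num)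
  rw [ProbabilityTheory.cond, ProbabilityTheory.cond, lintegral_smul_measure,
    lintegral_smul_measure, smul_eq_mul, smul_eq_mul, hvol,
    ENNReal.mul_inv (Or.inl h2) (Or.inl h2'), ← mul_assoc, ← mul_assoc,
    ENNReal.mul_inv_cancel h2 h2', one_mul]
  refine mul_le_mul_right (lintegral_mono_set (closedBall_subset_closedBall' ?_)) _
  have : dist u p ≤ R := hu
  rw [dist_comm]
  linarith

/-- Good points in a common ball can be joined at low cost avoiding a set of vanishing codimension
one Hausdorff measure. -/
theorem joinedBy_of_isGoodPoint (hn : 2 ≤ n) {E : Set (EuclideanSpace ℝ (Fin n))}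
    (hE : Measure.hausdorffMeasure ((n : ℝ) - 1) E = 0)
    {ρ : EuclideanSpace ℝ (Fin n) → ℝ≥0∞} (hρ : Measurable ρ)
    {p u w : EuclideanSpace ℝ (Fin n)} {R : ℝ} (hR : 0 < R) {η : ℝ≥0∞}
    (hup : u ∈ closedBall p R) (hwp : w ∈ closedBall p R)
    (hu : IsGoodPoint (fun x => ρ x ^ (n : ℝ)) (2 * R) η u)
    (hw : IsGoodPoint (fun x => ρ x ^ (n : ℝ)) (2 * R) η w) :
    JoinedBy (Eᶜ ∪ {u, w}) ρ u w (2 ^ (n + 1) * segmentConst n * η ^ (n : ℝ)⁻¹) := by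
  have := isProbabilityMeasure_cond_closedBall p hR
  have hac : cond volume (closedBall p R) ≪ volume := cond_absolutelyContinuous
  have hN := hac.ae_le ((ae_segment_notMem hn hE u).and (ae_segment_notMem hn hE w))
  -- Outside the null set of bad intermediate points, some `y` has total cost at most the mean.
  obtain ⟨y, hyN, hy⟩ := exists_notMem_null_le_laverage
    (f := fun y => segmentCost ρ u y + segmentCost ρ w y)
    (IsProbabilityMeasure.ne_zero (cond volume (closedBall p R)))
    ((measurable_segmentCost hρ u).add (measurable_segmentCost hρ w)).aemeasurable hN
  simp only [mem_compl_iff, not_not] at hyN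
  rw [laverage_eq_lintegral, lintegral_add_left (measurable_segmentCost hρ u)] at hy
  have hcost : ∀ v ∈ closedBall p R, IsGoodPoint (fun x => ρ x ^ (n : ℝ)) (2 * R) η v →
      ∫⁻ y, segmentCost ρ v y ∂(cond volume (closedBall p R)) ≤
        2 ^ n * (segmentConst n * η ^ (n : ℝ)⁻¹) := fun v hv hgood =>
    (lintegral_cond_le_of_dist_le _ hR hv).trans
      (mul_le_mul_right (lintegral_segmentCost_le hn hρ (by linarith) hgood) _)
  have hseg : ∀ v, v ∈ ({u, w} : Set (EuclideanSpace ℝ (Fin n))) →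
      (∀ s ∈ Ioc (0 : ℝ) 1, v + s • (y - v) ∉ E) →
      JoinedBy (Eᶜ ∪ {u, w}) ρ v y (segmentCost ρ v y) := by
    intro v hv hvE
    refine joinedBy_segment hρ fun s hs => ?_
    rcases hs.1.eq_or_lt with rfl | h
    · exact Or.inr (by simpa using hv)
    · exact Or.inl (hvE s ⟨h, hs.2⟩)
  have hj := (hseg u (by simp) hyN.1).trans (hseg w (by simp) hyN.2).symm
  obtain ⟨g, L, hL, hg, h0, h1, hS, hc⟩ := hj
  refine ⟨g, L, hL, hg, h0, h1, hS, hc.trans (hy.trans ((add_le_add (hcost u hup hu)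
    (hcost w hwp hw)).trans (le_of_eq ?_)))⟩
  ring

end Averages

/-! ### Ball means of an admissible function are almost admissible for all joining paths. -/

section Comparison

open Metric ProbabilityTheory

variable {n : ℕ}

/-- The arclength parametrization is controlled only on `[0, L]`. Extending it by constants makes it
continuous everywhere, which gives the measurability needed for Fubini and push-forwards. -/
theorem Curve.exists_continuous_unitSpeed (γ : Curve n) (hγ : γ.Rectifiable) :
    ∃ (g : ℝ → EuclideanSpace ℝ (Fin n)) (L : ℝ), 0 ≤ L ∧ Continuous g ∧
      HasUnitSpeedOn g (Icc 0 L) ∧ g 0 = γ.toFun γ.a ∧ g L = γ.toFun γ.b ∧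
      ∀ ρ, γ.lineIntegral ρ = ∫⁻ t in Icc 0 L, ρ (g t) := by
  obtain ⟨hu, h0, h1⟩ := γ.arclengthParam_spec hγ
  have hL : 0 ≤ γ.length.toReal := ENNReal.toReal_nonneg
  have heq : EqOn γ.arclengthParam (IccExtend hL ((Icc 0 γ.length.toReal).domRestrict
      γ.arclengthParam)) (Icc 0 γ.length.toReal) := by
    intro t ht
    rw [IccExtend_of_mem _ _ ht, domRestrict_apply]
  refine ⟨_, _, hL, ?_, hu.congr heq, ?_, ?_, fun ρ => ?_⟩
  · exact (hu.lipschitzOnWith.continuousOn.domRestrict).Icc_extend'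
  · rw [← heq (left_mem_Icc.2 hL), h0]
  · rw [← heq (right_mem_Icc.2 hL), h1]
  · exact setLIntegral_congr_fun measurableSet_Icc fun t ht => congrArg ρ (heq ht)

theorem JoinedBy.mono {S T : Set (EuclideanSpace ℝ (Fin n))}
    {ρ : EuclideanSpace ℝ (Fin n) → ℝ≥0∞} {u v : EuclideanSpace ℝ (Fin n)} {c : ℝ≥0∞}
    (h : JoinedBy S ρ u v c) (hST : S ⊆ T) : JoinedBy T ρ u v c := by
  obtain ⟨g, L, hL, hg, h0, h1, hS, hc⟩ := h
  exact ⟨g, L, hL, hg, h0, h1, hS.mono_right hST, hc⟩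

/-- The points `u` and `v` may belong to `E`: the avoiding family discards endpoint values from the
trace. -/
theorem Admissible.one_le_of_joinedBy {E F₁ F₂ : Set (EuclideanSpace ℝ (Fin n))}
    {ρ : EuclideanSpace ℝ (Fin n) → ℝ≥0∞}
    (hρ : Admissible (joiningFamily F₁ F₂ univ ∩ avoidingFamily E) ρ)
    {u v : EuclideanSpace ℝ (Fin n)} (hu : u ∈ F₁) (hv : v ∈ F₂) {c : ℝ≥0∞}
    (h : JoinedBy (Eᶜ ∪ {u, v}) ρ u v c) : 1 ≤ c := by
  obtain ⟨g, L, hL, hg, h0, h1, hS, hc⟩ := h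
  have hmem : Curve.ofUnitSpeed g L hL hg ∈ joiningFamily F₁ F₂ univ ∩ avoidingFamily E := by
    refine ⟨⟨by simp, by simpa [Curve.ofUnitSpeed, h0], by simpa [Curve.ofUnitSpeed, h1],
      subset_univ _⟩, ?_⟩
    rw [avoidingFamily, mem_ofPred_eq, disjoint_left]
    rintro _ ⟨⟨t, ht, rfl⟩, hend⟩ hE
    rcases hS ht with h | h
    · exact h hE
    · apply hend
      rw [← h0, ← h1] at h
      exact h
  have := hρ.one_le_lineIntegral _ hmem (by
    rw [Curve.Rectifiable, Curve.ofUnitSpeed_length]; exact ENNReal.ofReal_ne_top)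
  rw [Curve.ofUnitSpeed_lineIntegral] at this
  exact this.trans hc

/-- A translate of an arc joining `F₁` to `F₂` that avoids `E` and has good endpoints can be
completed to an arc that joins `F₁` to `F₂` and avoids `E`. -/
theorem Admissible.one_le_translate_add (hn : 2 ≤ n) {E F₁ F₂ : Set (EuclideanSpace ℝ (Fin n))}
    (hE : Measure.hausdorffMeasure ((n : ℝ) - 1) E = 0)
    {ρ : EuclideanSpace ℝ (Fin n) → ℝ≥0∞}
    (hρ : Admissible (joiningFamily F₁ F₂ univ ∩ avoidingFamily E) ρ)
    (hF₁ : IsPreconnected F₁) (hF₂ : IsPreconnected F₂) {R : ℝ} (hR : 0 < R)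
    (hd₁ : ∀ p ∈ F₁, ∃ z ∈ F₁, R ≤ dist z p) (hd₂ : ∀ p ∈ F₂, ∃ z ∈ F₂, R ≤ dist z p)
    {η : ℝ≥0∞} (hη : ∀ p, 20 * ∫⁻ x in closedBall p (3 * R), ρ x ^ (n : ℝ) < η)
    {g : ℝ → EuclideanSpace ℝ (Fin n)} {L : ℝ} (hL : 0 ≤ L) (hg : HasUnitSpeedOn g (Icc 0 L))
    (h0 : g 0 ∈ F₁) (h1 : g L ∈ F₂) {x : EuclideanSpace ℝ (Fin n)} (hx : x ∈ closedBall 0 R)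
    (hg0 : IsGoodPoint (fun x => ρ x ^ (n : ℝ)) (2 * R) η (g 0 + x))
    (hg1 : IsGoodPoint (fun x => ρ x ^ (n : ℝ)) (2 * R) η (g L + x))
    (hxE : ∀ t ∈ Icc 0 L, g t + x ∉ E) :
    1 ≤ (∫⁻ t in Icc 0 L, ρ (g t + x)) +
      2 * (2 ^ (n + 1) * segmentConst n * η ^ (n : ℝ)⁻¹) := by
  set c := 2 ^ (n + 1) * segmentConst n * η ^ (n : ℝ)⁻¹ with hc
  -- Near `p` there is a good point `w` of `F`; it may lie in `E`, which is harmless because it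
  -- becomes an endpoint of the completed arc.
  have hconn : ∀ F : Set (EuclideanSpace ℝ (Fin n)), IsPreconnected F →
      (∀ p ∈ F, ∃ z ∈ F, R ≤ dist z p) → ∀ p ∈ F, p + x ∉ E →
      IsGoodPoint (fun x => ρ x ^ (n : ℝ)) (2 * R) η (p + x) →
      ∃ w ∈ F, JoinedBy (Eᶜ ∪ {w}) ρ w (p + x) c := by
    intro F hF hd p hp hpE hgood
    obtain ⟨z, hz, hpz⟩ := hd p hp
    obtain ⟨w, hw, hwp, hwg⟩ := exists_isGoodPoint_of_isPreconnected
      (fun x => ρ x ^ (n : ℝ)) hR (hη p) hF hp hz hpz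
    refine ⟨w, hw, (joinedBy_of_isGoodPoint hn hE hρ.measurable hR hwp ?_ hwg hgood).mono ?_⟩
    · simpa using hx
    · rintro y (hy | rfl | rfl)
      · exact Or.inl hy
      · exact Or.inr rfl
      · exact Or.inl hpE
  obtain ⟨w₁, hw₁, hj₁⟩ := hconn F₁ hF₁ hd₁ _ h0 (hxE 0 (left_mem_Icc.2 hL)) hg0
  obtain ⟨w₂, hw₂, hj₂⟩ := hconn F₂ hF₂ hd₂ _ h1 (hxE L (right_mem_Icc.2 hL)) hg1
  have hmid : JoinedBy Eᶜ ρ (g 0 + x) (g L + x) (∫⁻ t in Icc 0 L, ρ (g t + x)) := by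
    refine ⟨fun t => g t + x, L, hL, ?_, rfl, rfl, fun t ht => hxE t ht, le_rfl⟩
    intro s hs t ht
    rw [← hg hs ht]
    simp only [eVariationOn, edist_add_right]
  have hall := ((hj₁.mono (T := Eᶜ ∪ {w₁, w₂}) (by grind)).trans
    (hmid.mono subset_union_left)).trans
    (hj₂.symm.mono (T := Eᶜ ∪ {w₁, w₂}) (by grind))
  refine (hρ.one_le_of_joinedBy hw₁ hw₂ hall).trans (le_of_eq ?_)
  ring

/-- The mean of `ρ` over the ball of radius `R` centred at a point. -/
noncomputable def ballMean (ρ : EuclideanSpace ℝ (Fin n) → ℝ≥0∞) (R : ℝ)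
    (y : EuclideanSpace ℝ (Fin n)) : ℝ≥0∞ :=
  ∫⁻ x, ρ (y + x) ∂(cond volume (closedBall 0 R))

theorem measurable_ballMean {ρ : EuclideanSpace ℝ (Fin n) → ℝ≥0∞} (hρ : Measurable ρ) (R : ℝ) :
    Measurable (ballMean ρ R) := by
  unfold ballMean
  apply Measurable.lintegral_prod_right'
    (f := fun z : EuclideanSpace ℝ (Fin n) × EuclideanSpace ℝ (Fin n) => ρ (z.1 + z.2))
  fun_prop

/-- Jensen for the uniform probability on the ball, then Fubini and translation invariance. -/
theorem lintegral_ballMean_rpow_le {ρ : EuclideanSpace ℝ (Fin n) → ℝ≥0∞} (hρ : Measurable ρ)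
    {R : ℝ} (hR : 0 < R) {p : ℝ} (hp : 1 < p) :
    ∫⁻ y, ballMean ρ R y ^ p ≤ ∫⁻ y, ρ y ^ p := by
  have := isProbabilityMeasure_cond_closedBall (0 : EuclideanSpace ℝ (Fin n)) hR
  calc ∫⁻ y, ballMean ρ R y ^ p
      ≤ ∫⁻ y, ∫⁻ x, ρ (y + x) ^ p ∂(cond volume (closedBall 0 R)) :=
        lintegral_mono fun y => rpow_lintegral_le _ (by fun_prop) hp
    _ = ∫⁻ x, (∫⁻ y, ρ (y + x) ^ p) ∂(cond volume (closedBall 0 R)) :=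
        lintegral_lintegral_swap (by fun_prop)
    _ = ∫⁻ _, (∫⁻ y, ρ y ^ p) ∂(cond volume (closedBall (0 : EuclideanSpace ℝ (Fin n)) R)) := by
        congr 1
        ext x
        exact lintegral_add_right_eq_self (fun y => ρ y ^ p) x
    _ = _ := by simp

theorem cond_not_isGoodPoint_le (hn : n ≠ 0) (f : EuclideanSpace ℝ (Fin n) → ℝ≥0∞)
    (p : EuclideanSpace ℝ (Fin n)) {R : ℝ} (hR : 0 < R) (η : ℝ≥0∞) :
    η * cond volume (closedBall 0 R) {x | ¬ IsGoodPoint f (2 * R) η (p + x)} ≤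
      10 ^ n * ∫⁻ x in closedBall p (3 * R), f x := by
  have hset : closedBall 0 R ∩ {x | ¬ IsGoodPoint f (2 * R) η (p + x)} =
      (fun x => p + x) ⁻¹' {u ∈ closedBall p R | ¬ IsGoodPoint f (2 * R) η u} := by
    ext x
    simp [dist_eq_norm]
  have h := mul_volume_not_isGoodPoint_le hn f p hR η
  have hV : volume (closedBall p R) = volume (closedBall (0 : EuclideanSpace ℝ (Fin n)) R) := by
    rw [volume_closedBall_eq _ hR.le, volume_closedBall_eq _ hR.le]
  rw [cond_apply measurableSet_closedBall, hset, measure_preimage_add, ← hV, mul_left_comm,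
    mul_comm, ← div_eq_mul_inv]
  exact ENNReal.div_le_of_le_mul h

/-- For every arc joining `F₁` to `F₂`, the ball means of an admissible function have line integral
close to at least one. -/
theorem Admissible.le_lintegral_ballMean (hn : 2 ≤ n) {E F₁ F₂ : Set (EuclideanSpace ℝ (Fin n))}
    (hE : Measure.hausdorffMeasure ((n : ℝ) - 1) E = 0)
    {ρ : EuclideanSpace ℝ (Fin n) → ℝ≥0∞}
    (hρ : Admissible (joiningFamily F₁ F₂ univ ∩ avoidingFamily E) ρ)
    (hF₁ : IsPreconnected F₁) (hF₂ : IsPreconnected F₂) {R : ℝ} (hR : 0 < R)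
    (hd₁ : ∀ p ∈ F₁, ∃ z ∈ F₁, R ≤ dist z p) (hd₂ : ∀ p ∈ F₂, ∃ z ∈ F₂, R ≤ dist z p)
    {η δ : ℝ≥0∞} (hη0 : η ≠ 0) (hηt : η ≠ ∞)
    (hη : ∀ p, 20 * ∫⁻ x in closedBall p (3 * R), ρ x ^ (n : ℝ) < η)
    (hδ : ∀ p, 2 * 10 ^ n * ∫⁻ x in closedBall p (3 * R), ρ x ^ (n : ℝ) ≤ η * δ)
    (hηδ : 2 * (2 ^ (n + 1) * segmentConst n * η ^ (n : ℝ)⁻¹) ≤ δ)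
    {g : ℝ → EuclideanSpace ℝ (Fin n)} {L : ℝ} (hL : 0 ≤ L) (hgc : Continuous g)
    (hg : HasUnitSpeedOn g (Icc 0 L)) (h0 : g 0 ∈ F₁) (h1 : g L ∈ F₂) :
    (1 - δ) * (1 - δ) ≤ ∫⁻ t in Icc 0 L, ballMean ρ R (g t) := by
  have hprob := isProbabilityMeasure_cond_closedBall (0 : EuclideanSpace ℝ (Fin n)) hR
  have hρm := hρ.measurable
  set ν := cond volume (closedBall (0 : EuclideanSpace ℝ (Fin n)) R) with hν
  set f : EuclideanSpace ℝ (Fin n) → ℝ≥0∞ := fun x => ρ x ^ (n : ℝ) with hf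
  set H : EuclideanSpace ℝ (Fin n) → ℝ≥0∞ := fun x => ∫⁻ t in Icc 0 L, ρ (g t + x) with hH
  have hHm : Measurable H := by
    apply Measurable.lintegral_prod_right'
      (f := fun z : EuclideanSpace ℝ (Fin n) × ℝ => ρ (g z.2 + z.1))
    fun_prop
  have hac : ν ≪ volume := cond_absolutelyContinuous
  have hnull : ν {x | ¬ ∀ t ∈ Icc 0 L, g t + x ∉ E} = 0 :=
    hac (ae_iff.1 (ae_translate_notMem hn hE hL hg.lipschitzOnWith))
  have hout : ν (closedBall 0 R)ᶜ = 0 := by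
    rw [hν, cond_apply measurableSet_closedBall, inter_compl_self, measure_empty, mul_zero]
  -- Each endpoint is bad with probability at most `δ / 2`.
  have hbad : ∀ p, 2 * ν {x | ¬ IsGoodPoint f (2 * R) η (p + x)} ≤ δ := by
    intro p
    rw [← ENNReal.mul_le_mul_iff_right hη0 hηt]
    calc η * (2 * ν {x | ¬ IsGoodPoint f (2 * R) η (p + x)})
        = 2 * (η * ν {x | ¬ IsGoodPoint f (2 * R) η (p + x)}) := by ring
      _ ≤ 2 * (10 ^ n * ∫⁻ x in closedBall p (3 * R), f x) :=
        mul_le_mul_right (cond_not_isGoodPoint_le (by omega) f p hR η) _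
      _ ≤ η * δ := by rw [← mul_assoc]; exact hδ p
  have hcompl : ν {x | 1 - δ ≤ H x}ᶜ ≤ δ := by
    have hsub : {x | 1 - δ ≤ H x}ᶜ ⊆ ({x | ¬ IsGoodPoint f (2 * R) η (g 0 + x)} ∪
        {x | ¬ IsGoodPoint f (2 * R) η (g L + x)}) ∪
        ({x | ¬ ∀ t ∈ Icc 0 L, g t + x ∉ E} ∪ (closedBall 0 R)ᶜ) := by
      intro x hx
      by_contra hcon
      simp only [mem_union, mem_ofPred_eq, mem_compl_iff, not_or, not_not] at hcon
      obtain ⟨⟨hg0, hg1⟩, hxE, hxR⟩ := hcon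
      apply hx
      have := hρ.one_le_translate_add hn hE hF₁ hF₂ hR hd₁ hd₂ hη hL hg h0 h1 hxR hg0 hg1 hxE
      exact tsub_le_iff_right.2 (this.trans (add_le_add_right hηδ _))
    refine (measure_mono hsub).trans ((measure_union_le _ _).trans ?_)
    rw [measure_union_null hnull hout, add_zero]
    refine (measure_union_le _ _).trans ?_
    rw [← ENNReal.mul_le_mul_iff_right two_ne_zero ENNReal.ofNat_ne_top, mul_add]
    exact (add_le_add (hbad _) (hbad _)).trans (two_mul δ).ge
  have hmeas : MeasurableSet {x | 1 - δ ≤ H x} := measurableSet_le measurable_const hHm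
  have hbig : 1 - δ ≤ ν {x | 1 - δ ≤ H x} := by
    rw [tsub_le_iff_right]
    exact (prob_add_prob_compl (μ := ν) hmeas).ge.trans (add_le_add_right hcompl _)
  -- Markov's inequality, then Fubini turns the mean cost of translates into the line integral of
  -- the ball mean.
  calc (1 - δ) * (1 - δ) ≤ (1 - δ) * ν {x | 1 - δ ≤ H x} := mul_le_mul_right hbig _
    _ ≤ ∫⁻ x, H x ∂ν := mul_meas_ge_le_lintegral hHm _
    _ = ∫⁻ t in Icc 0 L, ballMean ρ R (g t) := lintegral_lintegral_swap (by fun_prop)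

/-- Absolute continuity of the integral; uniform in `p` because the volume of a ball does not depend
on its centre. -/
theorem exists_radius_setLIntegral_lt {f : EuclideanSpace ℝ (Fin n) → ℝ≥0∞} (hn : n ≠ 0)
    (hf : ∫⁻ x, f x ≠ ∞) {τ : ℝ≥0∞} (hτ : τ ≠ 0) {d : ℝ} (hd : 0 < d) :
    ∃ R, 0 < R ∧ R ≤ d ∧ ∀ p, ∫⁻ x in closedBall p (3 * R), f x < τ := by
  obtain ⟨δ, hδ, h⟩ := exists_pos_setLIntegral_lt_of_measure_lt hf hτ
  have ht : Tendsto (fun R : ℝ => ENNReal.ofReal ((3 * R) ^ n) *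
      volume (ball (0 : EuclideanSpace ℝ (Fin n)) 1)) (𝓝[>] 0) (𝓝 0) := by
    have h1 : Tendsto (fun R : ℝ => (3 * R) ^ n) (𝓝[>] 0) (𝓝 0) := by
      have : Tendsto (fun R : ℝ => (3 * R) ^ n) (𝓝 0) (𝓝 ((3 * 0) ^ n)) :=
        Continuous.tendsto (by fun_prop) 0
      rw [mul_zero, zero_pow hn] at this
      exact this.mono_left nhdsWithin_le_nhds
    have h2 := ENNReal.Tendsto.mul_const (b := volume (ball (0 : EuclideanSpace ℝ (Fin n)) 1))
      (ENNReal.tendsto_ofReal h1) (Or.inr measure_ball_lt_top.ne)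
    simpa using h2
  obtain ⟨R, hlt, hR⟩ := ((ht.eventually_lt_const hδ).and (Ioc_mem_nhdsGT hd)).exists
  refine ⟨R, hR.1, hR.2, fun p => h _ ?_⟩
  rwa [volume_closedBall_eq _ (by linarith [hR.1])]

/-- The modulus of the family of all joining curves is controlled by functions that are
admissible for the curves avoiding a set of vanishing codimension one Hausdorff measure. -/
theorem Admissible.modulus_joiningFamily_le (hn : 2 ≤ n)
    {E F₁ F₂ : Set (EuclideanSpace ℝ (Fin n))}
    (hE : Measure.hausdorffMeasure ((n : ℝ) - 1) E = 0)
    {ρ : EuclideanSpace ℝ (Fin n) → ℝ≥0∞}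
    (hρ : Admissible (joiningFamily F₁ F₂ univ ∩ avoidingFamily E) ρ)
    (hF₁ : IsPreconnected F₁) (hF₂ : IsPreconnected F₂) {d : ℝ} (hd : 0 < d)
    (hd₁ : ∀ p ∈ F₁, ∃ z ∈ F₁, d ≤ dist z p) (hd₂ : ∀ p ∈ F₂, ∃ z ∈ F₂, d ≤ dist z p) :
    modulus (n : ℝ) (joiningFamily F₁ F₂ univ) ≤ ∫⁻ x, ρ x ^ (n : ℝ) := by
  rcases eq_or_ne (∫⁻ x, ρ x ^ (n : ℝ)) ∞ with hI | hI
  · rw [hI]; exact le_top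
  have hn1 : (1 : ℝ) < n := by exact_mod_cast (by omega : 1 < n)
  have hn0 : (0 : ℝ) < (n : ℝ) := by linarith
  have hstep : ∀ δ : ℝ≥0∞, 0 < δ → δ < 1 → modulus (n : ℝ) (joiningFamily F₁ F₂ univ) ≤
      (((1 - δ) * (1 - δ))⁻¹) ^ (n : ℝ) * ∫⁻ x, ρ x ^ (n : ℝ) := by
    intro δ hδ0 hδ1
    have hδt : δ ≠ ∞ := (hδ1.trans ENNReal.one_lt_top).ne
    obtain ⟨η, hη0, hηt, hηδ⟩ : ∃ η : ℝ≥0∞, η ≠ 0 ∧ η ≠ ∞ ∧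
        2 * (2 ^ (n + 1) * segmentConst n * η ^ (n : ℝ)⁻¹) ≤ δ := by
      have hK : 2 * (2 ^ (n + 1) * segmentConst n) ≠ ∞ := ENNReal.mul_ne_top (by norm_num)
        (ENNReal.mul_ne_top (ENNReal.pow_ne_top (by norm_num)) (segmentConst_ne_top hn))
      obtain ⟨ε, ⟨h1, h2⟩, h3⟩ := (((eventually_const_mul_lt hK hδ0).and
        (eventually_const_mul_lt (a := 1) (b := 1) (by norm_num) (by norm_num))).and
        self_mem_nhdsWithin).exists
      rw [one_mul] at h2
      -- The power `n` undoes the root in the connection cost; `ε < 1` serves only to keep `η`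
      -- finite.
      refine ⟨ε ^ (n : ℝ), (ENNReal.rpow_pos h3 (h2.trans ENNReal.one_lt_top).ne).ne',
        ENNReal.rpow_ne_top_of_nonneg hn0.le (h2.trans ENNReal.one_lt_top).ne, ?_⟩
      rw [ENNReal.rpow_rpow_inv hn0.ne', ← mul_assoc]
      exact h1.le
    have hηδ0 : 0 < η * δ := ENNReal.mul_pos hη0 hδ0.ne'
    have h10 : (2 * 10 ^ n : ℝ≥0∞) ≠ ∞ :=
      ENNReal.mul_ne_top (by norm_num) (ENNReal.pow_ne_top (by norm_num))
    -- `τ` bounds the energy in all balls of radius `3R`: its first condition yields good points on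
    -- the continua, its second makes bad translates rare.
    obtain ⟨τ, ⟨hτ1, hτ2⟩, hτ0⟩ := (((eventually_const_mul_lt (a := 20) (by norm_num)
      (pos_iff_ne_zero.2 hη0)).and (eventually_const_mul_lt h10 hηδ0)).and
      self_mem_nhdsWithin).exists
    obtain ⟨R, hR0, hRd, hR⟩ := exists_radius_setLIntegral_lt (by omega) hI
      (pos_iff_ne_zero.1 hτ0) hd
    have hpos : (1 - δ) * (1 - δ) ≠ 0 :=
      mul_ne_zero (tsub_pos_of_lt hδ1).ne' (tsub_pos_of_lt hδ1).ne'
    have hfin : (1 - δ) * (1 - δ) ≠ ∞ := ENNReal.mul_ne_top (by simp) (by simp)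
    have hadm : Admissible (joiningFamily F₁ F₂ univ)
        (fun x => ((1 - δ) * (1 - δ))⁻¹ * ballMean ρ R x) := by
      refine ⟨(measurable_ballMean hρ.measurable R).const_mul _, fun γ hγ hrect => ?_⟩
      obtain ⟨g, L, hL, hgc, hg, h0, h1, hline⟩ := γ.exists_continuous_unitSpeed hrect
      have := hρ.le_lintegral_ballMean hn hE hF₁ hF₂ hR0
        (fun p hp => (hd₁ p hp).imp fun z hz => ⟨hz.1, hRd.trans hz.2⟩)
        (fun p hp => (hd₂ p hp).imp fun z hz => ⟨hz.1, hRd.trans hz.2⟩) hη0 hηt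
        (fun p => (mul_le_mul_right (hR p).le _).trans_lt hτ1)
        (fun p => (mul_le_mul_right (hR p).le _).trans hτ2.le) hηδ hL hgc hg
        (h0 ▸ hγ.2.1) (h1 ▸ hγ.2.2.1)
      have hm : Measurable fun t => ballMean ρ R (g t) :=
        (measurable_ballMean hρ.measurable R).comp hgc.measurable
      rw [hline, lintegral_const_mul _ hm, mul_comm, ← div_eq_mul_inv, ENNReal.le_div_iff_mul_le (Or.inl hpos)
        (Or.inl hfin), one_mul]
      exact this
    refine (iInf₂_le _ hadm).trans ?_
    simp only [ENNReal.mul_rpow_of_nonneg _ _ hn0.le]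
    rw [lintegral_const_mul _ ((measurable_ballMean hρ.measurable R).pow_const _)]
    exact mul_le_mul_right (lintegral_ballMean_rpow_le hρ.measurable hR0 hn1) _
  have htend : Tendsto (fun δ : ℝ≥0∞ => (((1 - δ) * (1 - δ))⁻¹) ^ (n : ℝ) *
      ∫⁻ x, ρ x ^ (n : ℝ)) (𝓝[>] 0)
      (𝓝 ((((1 - 0) * (1 - 0))⁻¹) ^ (n : ℝ) * ∫⁻ x, ρ x ^ (n : ℝ))) := by
    have h1 : Tendsto (fun δ : ℝ≥0∞ => 1 - δ) (𝓝[>] 0) (𝓝 (1 - 0)) :=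
      (ENNReal.Tendsto.sub tendsto_const_nhds tendsto_id (Or.inl (by norm_num))).mono_left
        nhdsWithin_le_nhds
    refine ENNReal.Tendsto.mul_const ?_ (Or.inr hI)
    refine (ENNReal.continuous_rpow_const.tendsto _).comp ?_
    exact (ENNReal.Tendsto.mul h1 (by simp) h1 (by simp)).inv
  simp only [tsub_zero, mul_one, inv_one, ENNReal.one_rpow, one_mul] at htend
  refine ge_of_tendsto htend ?_
  filter_upwards [Ioo_mem_nhdsGT (show (0 : ℝ≥0∞) < 1 from one_pos)] with δ hδ
  exact hstep δ hδ.1 hδ.2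

end Comparison

/-! ### Paths ending at a given point have modulus zero. -/

section PointModulus

open Metric

variable {n : ℕ}

/-- 1-Lipschitz maps do not increase one-dimensional measure. Applied to the distance to `p` along
an arc, this bounds the line integral of a radial density below by its integral over the radii. -/
theorem volume_restrict_le_map_of_lipschitzOnWith {h : ℝ → ℝ} {s t : Set ℝ} (hm : Measurable h)
    (hh : LipschitzOnWith 1 h s) (hst : t ⊆ h '' s) :
    volume.restrict t ≤ Measure.map h (volume.restrict s) := by
  rw [Measure.le_iff]
  intro B hB
  rw [Measure.map_apply hm hB, Measure.restrict_apply hB, Measure.restrict_apply (hm hB)]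
  have hsub : B ∩ t ⊆ h '' (h ⁻¹' B ∩ s) := by
    rintro y ⟨hyB, hyt⟩
    obtain ⟨x, hx, rfl⟩ := hst hyt
    exact ⟨x, ⟨hyB, hx⟩, rfl⟩
  have hlip := (hh.mono (inter_subset_right (s := h ⁻¹' B))).hausdorffMeasure_image_le zero_le_one
  rw [hausdorffMeasure_real, ENNReal.coe_one, ENNReal.one_rpow, one_mul] at hlip
  exact (measure_mono hsub).trans hlip

/-- The logarithmic density used to show that the curves through a point have modulus zero. -/
noncomputable def logDensity (r : ℝ) (j : ℕ) : ℝ → ℝ :=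
  (Ioc (r * Real.exp (-j)) r).indicator fun y => (j : ℝ)⁻¹ * y⁻¹

theorem logDensity_nonneg {r : ℝ} (hr : 0 < r) (j : ℕ) (y : ℝ) : 0 ≤ logDensity r j y := by
  refine indicator_nonneg (fun y hy => ?_) y
  have : 0 < r * Real.exp (-j) := by positivity
  have : 0 < y := this.trans hy.1
  positivity

theorem measurable_logDensity (r : ℝ) (j : ℕ) : Measurable (logDensity r j) :=
  (measurable_inv.const_mul _).indicator measurableSet_Ioc

theorem integrableOn_inv_Ioc {r : ℝ} (hr : 0 < r) (j : ℕ) :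
    IntegrableOn (fun y : ℝ => y⁻¹) (Ioc (r * Real.exp (-j)) r) ∧
      ∫ y in Ioc (r * Real.exp (-j)) r, y⁻¹ = j := by
  have hle : r * Real.exp (-j) ≤ r := by
    apply mul_le_of_le_one_right hr.le
    rw [Real.exp_le_one_iff]
    simp
  have hpos : 0 < r * Real.exp (-j) := by positivity
  constructor
  · rw [← intervalIntegrable_iff_integrableOn_Ioc_of_le hle]
    refine intervalIntegral.intervalIntegrable_inv (fun x hx => ?_) continuousOn_id
    rw [uIcc_of_le hle] at hx
    exact (hpos.trans_le hx.1).ne'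
  · rw [← intervalIntegral.integral_of_le hle, integral_inv_of_pos hpos hr,
      div_mul_cancel_left₀ hr.ne', Real.exp_neg, inv_inv, Real.log_exp]

theorem setLIntegral_logDensity {r : ℝ} (hr : 0 < r) {j : ℕ} (hj : j ≠ 0) :
    ∫⁻ y in Icc 0 r, ENNReal.ofReal (logDensity r j y) = 1 := by
  have hpos : 0 < r * Real.exp (-j) := by positivity
  obtain ⟨hint, hval⟩ := integrableOn_inv_Ioc hr j
  have h1 : ∀ y, ENNReal.ofReal (logDensity r j y) = (Ioc (r * Real.exp (-j)) r).indicator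
      (fun y => ENNReal.ofReal ((j : ℝ)⁻¹ * y⁻¹)) y := by
    intro y
    unfold logDensity
    by_cases hy : y ∈ Ioc (r * Real.exp (-j)) r
    · rw [indicator_of_mem hy, indicator_of_mem hy]
    · rw [indicator_of_notMem hy, indicator_of_notMem hy, ENNReal.ofReal_zero]
  have hsub : Ioc (r * Real.exp (-j)) r ⊆ Icc 0 r := Ioc_subset_Icc_self.trans
    (Icc_subset_Icc_left hpos.le)
  rw [lintegral_congr h1, lintegral_indicator measurableSet_Ioc,
    Measure.restrict_restrict measurableSet_Ioc,
    inter_eq_left.2 hsub,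
    ← ofReal_integral_eq_lintegral_ofReal (hint.const_mul _), integral_const_mul, hval,
    inv_mul_cancel₀ (by exact_mod_cast hj), ENNReal.ofReal_one]
  filter_upwards [ae_restrict_mem measurableSet_Ioc] with y hy
  have : 0 < y := hpos.trans hy.1
  positivity

/-- In polar coordinates the integrand `yⁿ⁻¹ (j y)⁻ⁿ` is `j⁻ⁿ y⁻¹`, and `y⁻¹` integrates to `j` over
the annulus. The result is a multiple of `j^(1 - n)`, at most that of `1 / j` as `n ≥ 2`. -/
theorem lintegral_logDensity_pow (hn : 2 ≤ n) (p : EuclideanSpace ℝ (Fin n)) {r : ℝ} (hr : 0 < r)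
    {j : ℕ} (hj : j ≠ 0) :
    ∫⁻ x, ENNReal.ofReal (logDensity r j (dist x p)) ^ (n : ℝ) ≤
      ENNReal.ofReal (n * (volume (ball (0 : EuclideanSpace ℝ (Fin n)) 1)).toReal / j) := by
  have hpos : 0 < r * Real.exp (-j) := by positivity
  have hj1 : (1 : ℝ) ≤ j := by exact_mod_cast Nat.one_le_iff_ne_zero.2 hj
  have : Nontrivial (EuclideanSpace ℝ (Fin n)) := by
    apply Module.nontrivial_of_finrank_pos (R := ℝ)
    rw [finrank_euclideanSpace_fin]
    omega
  obtain ⟨hint, hval⟩ := integrableOn_inv_Ioc hr j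
  have h1 : ∀ y, y ^ (n - 1) • logDensity r j y ^ n =
      (Ioc (r * Real.exp (-j)) r).indicator (fun y => ((j : ℝ)⁻¹) ^ n * y⁻¹) y := by
    intro y
    unfold logDensity
    by_cases hy : y ∈ Ioc (r * Real.exp (-j)) r
    · have hy0 : y ≠ 0 := (hpos.trans hy.1).ne'
      rw [indicator_of_mem hy, indicator_of_mem hy, smul_eq_mul, mul_pow, mul_left_comm,
        ← mul_pow_sub_one (by omega : n ≠ 0) y⁻¹, mul_left_comm (y ^ (n - 1)), ← mul_pow,
        mul_inv_cancel₀ hy0, one_pow, mul_one]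
    · rw [indicator_of_notMem hy, indicator_of_notMem hy, zero_pow (by omega), smul_zero]
  have hsub : Ioc (r * Real.exp (-j)) r ⊆ Ioi 0 := fun y hy => hpos.trans hy.1
  have hI : Integrable (fun x : EuclideanSpace ℝ (Fin n) => logDensity r j ‖x‖ ^ n) := by
    rw [integrable_fun_norm_addHaar volume (f := fun y => logDensity r j y ^ n),
      finrank_euclideanSpace_fin]
    simp only [h1]
    exact ((integrable_indicator_iff measurableSet_Ioc).2 (hint.const_mul _)).integrableOn
  calc ∫⁻ x, ENNReal.ofReal (logDensity r j (dist x p)) ^ (n : ℝ)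
      = ∫⁻ x, ENNReal.ofReal (logDensity r j ‖x - p‖ ^ n) := by
        simp only [ENNReal.rpow_natCast, dist_eq_norm,
          ENNReal.ofReal_pow (logDensity_nonneg hr j _)]
    _ = ∫⁻ x : EuclideanSpace ℝ (Fin n), ENNReal.ofReal (logDensity r j ‖x‖ ^ n) :=
        lintegral_sub_right_eq_self
          (fun x : EuclideanSpace ℝ (Fin n) => ENNReal.ofReal (logDensity r j ‖x‖ ^ n)) p
    _ = ENNReal.ofReal (∫ x : EuclideanSpace ℝ (Fin n), logDensity r j ‖x‖ ^ n) :=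
        (ofReal_integral_eq_lintegral_ofReal hI
          (ae_of_all _ fun x => pow_nonneg (logDensity_nonneg hr j _) _)).symm
    _ ≤ _ := by
        apply ENNReal.ofReal_le_ofReal
        rw [integral_fun_norm_addHaar volume (fun y => logDensity r j y ^ n),
          finrank_euclideanSpace_fin]
        simp only [h1]
        rw [setIntegral_indicator measurableSet_Ioc, inter_eq_right.2 hsub, integral_const_mul,
          hval, nsmul_eq_mul, smul_eq_mul, ← mul_assoc, div_eq_mul_inv]
        refine mul_le_mul_of_nonneg_left ?_ (by positivity)
        obtain ⟨m, rfl⟩ : ∃ m, n = m + 2 := ⟨n - 2, by omega⟩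
        rw [pow_succ, mul_assoc, inv_mul_cancel₀ (by linarith), mul_one, pow_succ]
        exact mul_le_of_le_one_left (by positivity) (pow_le_one₀ (by positivity)
          (inv_le_one_of_one_le₀ hj1))

/-- Curves that join a point to the complement of a ball about that point have modulus zero. -/
theorem modulus_eq_zero_of_endpoint (hn : 2 ≤ n) (p : EuclideanSpace ℝ (Fin n)) {r : ℝ}
    (hr : 0 < r) {Γ : Set (Curve n)}
    (hΓ : ∀ γ ∈ Γ, (γ.toFun γ.a = p ∧ r ≤ dist (γ.toFun γ.b) p) ∨
      (γ.toFun γ.b = p ∧ r ≤ dist (γ.toFun γ.a) p)) :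
    modulus (n : ℝ) Γ = 0 := by
  have hstep : ∀ j : ℕ, j ≠ 0 → modulus (n : ℝ) Γ ≤
      ENNReal.ofReal (n * (volume (ball (0 : EuclideanSpace ℝ (Fin n)) 1)).toReal / j) := by
    intro j hj
    have hm : Measurable fun y => ENNReal.ofReal (logDensity r j y) :=
      (measurable_logDensity r j).ennreal_ofReal
    refine (iInf₂_le (fun x => ENNReal.ofReal (logDensity r j (dist x p))) ⟨?_, ?_⟩).trans
      (lintegral_logDensity_pow hn p hr hj)
    · exact hm.comp (by fun_prop)
    · intro γ hγ hrect
      obtain ⟨g, L, hL, hgc, hg, h0, h1, hline⟩ := γ.exists_continuous_unitSpeed hrect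
      have hdc : Continuous fun t => dist (g t) p := by fun_prop
      have hlip : LipschitzOnWith 1 (fun t => dist (g t) p) (Icc 0 L) := by
        have := (LipschitzWith.dist_left p).comp_lipschitzOnWith hg.lipschitzOnWith
        rwa [one_mul] at this
      have himg : Icc 0 r ⊆ (fun t => dist (g t) p) '' Icc 0 L := by
        rcases hΓ γ hγ with ⟨ha, hb⟩ | ⟨hb, ha⟩
        · have := intermediate_value_Icc hL hdc.continuousOn
          rw [h0, h1, ha, dist_self] at this
          exact (Icc_subset_Icc_right hb).trans this
        · have := intermediate_value_Icc' hL hdc.continuousOn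
          rw [h0, h1, hb, dist_self] at this
          exact (Icc_subset_Icc_right ha).trans this
      rw [hline, ← lintegral_map hm hdc.measurable, ← setLIntegral_logDensity hr hj]
      exact lintegral_mono' (volume_restrict_le_map_of_lipschitzOnWith hdc.measurable hlip
        himg) le_rfl
  refine le_antisymm (ge_of_tendsto (x := atTop) (f := fun j : ℕ => ENNReal.ofReal
    (n * (volume (ball (0 : EuclideanSpace ℝ (Fin n)) 1)).toReal / j)) ?_ ?_) bot_le
  · have := ENNReal.tendsto_ofReal (tendsto_const_div_atTop_nhds_zero_nat
      (n * (volume (ball (0 : EuclideanSpace ℝ (Fin n)) 1)).toReal))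
    rwa [ENNReal.ofReal_zero] at this
  · filter_upwards [eventually_ne_atTop 0] with j hj
    exact hstep j hj

end PointModulus

/-! ### Elementary facts on continua and the conclusion. -/

theorem modulus_mono {n : ℕ} {p : ℝ} {Γ Γ' : Set (Curve n)} (h : Γ ⊆ Γ') :
    modulus p Γ ≤ modulus p Γ' :=
  le_iInf₂ fun ρ hρ =>
    iInf₂_le ρ ⟨hρ.measurable, fun γ hγ => hρ.one_le_lineIntegral γ (h hγ)⟩

theorem forall_exists_le_dist {X : Type*} [PseudoMetricSpace X] {F : Set X} {a b : X}
    (ha : a ∈ F) (hb : b ∈ F) {d : ℝ} (hd : 2 * d ≤ dist a b) : ∀ p ∈ F, ∃ z ∈ F, d ≤ dist z p := by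
  intro p _
  by_contra! h
  have h1 := h a ha
  have h2 := h b hb
  have h3 := dist_triangle_right a b p
  linarith

theorem exists_pos_le_dist_of_disjoint {n : ℕ} {F : Set (EuclideanSpace ℝ (Fin n))}
    (hF : IsContinuum F) {p : EuclideanSpace ℝ (Fin n)} (hp : p ∉ F) :
    ∃ r : ℝ, 0 < r ∧ ∀ z ∈ F, r ≤ dist z p := by
  refine ⟨Metric.infDist p F, ?_, fun z hz => ?_⟩
  · exact (hF.1.isClosed.notMem_iff_infDist_pos hF.2.nonempty).1 hp
  · rw [dist_comm]
    exact Metric.infDist_le_dist_of_mem hz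

end QCNed

theorem theorem1p6 (n : ℕ) (hn : 2 ≤ n) (E : Set (EuclideanSpace ℝ (Fin n)))
    (hE : MeasureTheory.Measure.hausdorffMeasure ((n : ℝ) - 1) E = 0) :
    QCNed.IsNED E := by
  intro F₁ F₂ hF₁ hF₂ hdisj
  refine le_antisymm ?_ (QCNed.modulus_mono inter_subset_left)
  -- A one-point continuum has no point at positive distance from its own, so the search for nearby
  -- good points fails; the modulus is zero instead.
  rcases F₁.subsingleton_or_nontrivial with h₁ | ⟨a₁, ha₁, b₁, hb₁, hab₁⟩
  · obtain ⟨p, hp⟩ := hF₁.2.nonempty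
    obtain ⟨r, hr, hrd⟩ := QCNed.exists_pos_le_dist_of_disjoint hF₂ (disjoint_left.1 hdisj hp)
    rw [QCNed.modulus_eq_zero_of_endpoint hn p hr fun γ hγ =>
      Or.inl ⟨h₁ hγ.2.1 hp, hrd _ hγ.2.2.1⟩]
    exact bot_le
  rcases F₂.subsingleton_or_nontrivial with h₂ | ⟨a₂, ha₂, b₂, hb₂, hab₂⟩
  · obtain ⟨p, hp⟩ := hF₂.2.nonempty
    obtain ⟨r, hr, hrd⟩ := QCNed.exists_pos_le_dist_of_disjoint hF₁ (disjoint_right.1 hdisj hp)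
    rw [QCNed.modulus_eq_zero_of_endpoint hn p hr fun γ hγ =>
      Or.inr ⟨h₂ hγ.2.2.1 hp, hrd _ hγ.2.1⟩]
    exact bot_le
  set d := min (dist a₁ b₁) (dist a₂ b₂) / 2 with hd
  have hd0 : 0 < d := half_pos (lt_min (dist_pos.2 hab₁) (dist_pos.2 hab₂))
  have hd₁ : 2 * d ≤ dist a₁ b₁ := by rw [hd, mul_div_cancel₀ _ two_ne_zero]; exact min_le_left _ _
  have hd₂ : 2 * d ≤ dist a₂ b₂ := by rw [hd, mul_div_cancel₀ _ two_ne_zero]; exact min_le_right _ _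
  exact le_iInf₂ fun ρ hρ => hρ.modulus_joiningFamily_le hn hE hF₁.2.isPreconnected
    hF₂.2.isPreconnected hd0 (QCNed.forall_exists_le_dist ha₁ hb₁ hd₁)
    (QCNed.forall_exists_le_dist ha₂ hb₂ hd₂)
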